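/- Let $R\subset\mathbb R^n$ be an irreducible reduced (crystallographic) root system, with the Weyl-invariant Euclidean form $(\cdot,\cdot)$ normalized by $(\alpha,\alpha)=2$ for short roots (all roots are called short if they have the same length), $\nu_\alpha=(\alpha,\alpha)/2$, $\alpha^\vee=\alpha/\nu_\alpha$, simple roots $\alpha_1,\dots,\alpha_n$, positive roots $R_+$, Weyl group $W$ with longest element $w_0$, weight lattice $P$ and coweight lattice $P^\vee$. Let $P_+$ and $P_-=-P_+$ be the sets of dominant and antidominant weights. Consider two settings. In the untwisted one, the affine roots are $[\alpha,j]$ ($\alpha\in R$, $j\in\mathbb Z$), $\theta$ is the maximal root, $\check P=P^\vee$ and $\check\rho=\frac12\sum_{\alpha\in R_+}\alpha^\vee$. In the twisted one, the affine roots are $[\alpha,\nu_\alpha j]$, $\theta$ is the maximal short root, $\check P=P$ and $\check\rho=\frac12\sum_{\alpha\in R_+}\alpha$. In both cases $[\alpha,\cdot]$ is positive if $j>0$, or if $j=0$ and $\alpha\in R_+$, and $\alpha_0=[-\theta,1]$. On $\mathbb R^n\times\mathbb R$ set $s_{[\alpha,j]}([z,\zeta])=[z,\zeta]-(z,\alpha^\vee)[\alpha,j]$,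 $a([z,\zeta])=[z,\zeta-(z,a)]$ for $a\in\check P$, and $w([z,\zeta])=[w(z),\zeta]$ for $w\in W$. Let $\hat W=W\ltimes\check P$, let $l(\hat w)$ be the number of positive affine roots that $\hat w\in\hat W$ sends to negative ones, and let $\Pi\subset\hat W$ be the subgroup of elements that permute $\{\alpha_0,\dots,\alpha_n\}$. On the monomials $X_{[b,\zeta]}=q^\zeta X_b$ put $\hat w(X_{[b,\zeta]})=X_{\hat w([b,\zeta])}$, write $s_i=s_{\alpha_i}$, and for $0\le i\le n$ let $\mathbb T_i$ be the operator, linear over powers of $q$, with $$\mathbb T_i(X_b)=\begin{cases}s_i(X_b)+X_b,&(b,\alpha_i)<0,\\ X_b,&(b,\alpha_i)=0,\\ 0,&(b,\alpha_i)>0,\end{cases}$$ where $(b,\alpha_0)=-(b,\theta)$. For any reduced decomposition $\check\rho\,w_0=\pi\, s_{i_l}\cdots s_{i_1}$ with $\pi\in\Pi$ and $l=l(\check\rho\,w_0)$, put $\mathfrak T=\pi\,\mathbb T_{i_l}\cdots\mathbb T_{i_1}$, and for $b\in P_-$ let $$\mathbb E^\dagger_b=q^{(\check\rho,b)}\,\mathfrak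 T\Bigl(\sum_{c\in W(b)}X_c\Bigr).$$ **Theorem.** In each of the two settings there is a unique family of integers $e_c\ge 0$ $(c\in P)$ such that $\mathbb E^\dagger_b=\sum_{c\in W(b)}q^{-e_c}X_c$ for every $b\in P_-$ and every reduced decomposition of $\check\rho\,w_0$. The extremal dag-degrees $e(b,w):=e_{w(-b)}$ $(b\in P_+,\ w\in W)$ are additive: $$e(b+c,w)=e(b,w)+e(c,w)\qquad\text{for all } b,c\in P_+,\ w\in W.$$ -/

import Mathlib

noncomputable section

namespace ExtremalDag

/-- The two affine extensions of a finite root system: the untwisted one, with affine roots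
`[α, j]`, and the twisted one, with affine roots `[α, ν_α j]`, where `ν_α = (α, α) / 2`. -/
inductive Setting
  | untwisted
  | twisted

section Euclidean

variable {V : Type*} [NormedAddCommGroup V] [InnerProductSpace ℝ V]

/-- `(x, α^∨) = 2 (x, α) / (α, α)`. -/
def corootPairing (x α : V) : ℝ := 2 * inner ℝ x α / inner ℝ α α

/-- The affine reflection `s_α̃ (z̃) = z̃ - (z, α^∨) α̃` for `α̃ = [α, j]`, `z̃ = [z, ζ]`,
acting linearly on `V × ℝ`. -/
def affineReflection (α : V × ℝ) : Module.End ℝ (V × ℝ) where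
  toFun z := z - corootPairing z.1 α.1 • α
  map_add' x y := by
    simp only [corootPairing, Prod.fst_add, inner_add_left, mul_add, add_div, add_smul]
    abel
  map_smul' c x := by
    simp only [corootPairing, Prod.smul_fst, real_inner_smul_left, RingHom.id_apply, smul_sub,
      smul_smul]
    congr 2
    ring

/-- The translation `a([z, ζ]) = [z, ζ - (z, a)]`, acting linearly on `V × ℝ`. -/
def translation (a : V) : Module.End ℝ (V × ℝ) where
  toFun z := (z.1, z.2 - inner ℝ z.1 a)
  map_add' x y := by
    ext
    · rfl
    · simp only [Prod.fst_add, Prod.snd_add, inner_add_left]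
      ring
  map_smul' c x := by
    ext
    · rfl
    · simp only [Prod.smul_fst, Prod.smul_snd, real_inner_smul_left, RingHom.id_apply, smul_eq_mul]
      ring

variable (V) in
/-- Laurent polynomials in the `X_b` whose coefficients are Laurent polynomials in (possibly
fractional) powers of `q`: the group ring of `V × ℝ`, in which the pair `(b, ζ)` stands for
the monomial `X_{[b, ζ]} = q^ζ X_b`. -/
abbrev LaurentRing : Type _ := AddMonoidAlgebra ℤ (V × ℝ)

/-- The monomial `X_{[b, ζ]} = q^ζ X_b` for `z = [b, ζ]`. -/
def X (z : V × ℝ) : LaurentRing V := AddMonoidAlgebra.single z 1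

/-- The additive operator on Laurent polynomials with prescribed values on the monomials. -/
def linearExtension (f : V × ℝ → LaurentRing V) : LaurentRing V →ₗ[ℤ] LaurentRing V :=
  (Finsupp.linearCombination ℤ f).comp (AddMonoidAlgebra.coeffLinearEquiv ℤ).toLinearMap

theorem linearExtension_X (f : V × ℝ → LaurentRing V) (z : V × ℝ) :
    linearExtension f (X z) = f z := by
  simp [linearExtension, X, AddMonoidAlgebra.coeffLinearEquiv]

/-- The action of a linear transformation of `V × ℝ` on monomials, `g(X_z) = X_{g(z)}`. -/
def monomialAction (g : Module.End ℝ (V × ℝ)) : LaurentRing V →ₗ[ℤ] LaurentRing V :=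
  linearExtension fun z ↦ X (g z)

open Classical in
/-- The operator `𝕋_α̃`, for `α̃ = [α, j]`: it sends the monomial `X_b` (up to a power of `q`) to
`s_α̃(X_b) + X_b` if `(b, α) < 0`, to `X_b` if `(b, α) = 0`, and to `0` if `(b, α) > 0`. -/
def T (α : V × ℝ) : LaurentRing V →ₗ[ℤ] LaurentRing V :=
  linearExtension fun z ↦
    if inner ℝ z.1 α.1 < 0 then X (affineReflection α z) + X z
    else if inner ℝ z.1 α.1 = 0 then X z
    else 0

end Euclidean

section RootSystem

variable {ι V N : Type*} [Fintype ι] [NormedAddCommGroup V] [InnerProductSpace ℝ V]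
  [AddCommGroup N] [Module ℝ N]

/-- The inner product of `V` is the Euclidean form of the root system (the coroots are
`α^∨ = 2 α / (α, α)`, equivalently the form is invariant under the Weyl group), normalized by
`(α, α) = 2` for the short roots, that is, for the roots of minimal length. -/
structure IsNormalizedForm (P : RootPairing ι ℝ V N) : Prop where
  coroot_eq : ∀ (i : ι) (x : V), P.coroot' i x = corootPairing x (P.root i)
  short_eq_two : ∀ i : ι, (∀ j, ‖P.root i‖ ≤ ‖P.root j‖) →
    inner ℝ (P.root i) (P.root i) = (2 : ℝ)

/-- The weight lattice `P`. -/
def weightLattice (P : RootPairing ι ℝ V N) : AddSubgroup V where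
  carrier := {x | ∀ i, ∃ n : ℤ, P.coroot' i x = n}
  zero_mem' i := ⟨0, by simp⟩
  add_mem' {x y} hx hy i := by
    obtain ⟨m, hm⟩ := hx i
    obtain ⟨n, hn⟩ := hy i
    exact ⟨m + n, by rw [map_add, hm, hn]; push_cast; rfl⟩
  neg_mem' {x} hx i := by
    obtain ⟨m, hm⟩ := hx i
    exact ⟨-m, by rw [map_neg, hm]; push_cast; rfl⟩

theorem weyl_smul_mem (P : RootPairing ι ℝ V N) [P.IsCrystallographic] (w : P.weylGroup)
    {x : V} (hx : x ∈ weightLattice P) : w • x ∈ weightLattice P := by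
  obtain ⟨g, hg⟩ := w
  induction hg using RootPairing.weylGroup.induction generalizing x with
  | mem i =>
    intro j
    obtain ⟨m, hm⟩ := hx i
    obtain ⟨n, hn⟩ := hx j
    obtain ⟨k, hk⟩ := P.exists_value (S := ℤ) i j
    refine ⟨n - m * k, ?_⟩
    have h : (⟨RootPairing.Equiv.reflection P i, P.reflection_mem_weylGroup i⟩ : P.weylGroup) • x
        = P.reflection i x := rfl
    rw [h, P.reflection_apply, map_sub, map_smul, hn, hm, P.root_coroot'_eq_pairing, ← hk]
    simp
  | one => simpa using! hx
  | mul g₁ g₂ h₁ h₂ ih₁ ih₂ =>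
    rw [← Submonoid.mk_mul_mk _ g₁ g₂ h₁ h₂, mul_smul]
    exact ih₁ (ih₂ hx)

/-- The action of the Weyl group on the weight lattice. -/
def weylAct (P : RootPairing ι ℝ V N) [P.IsCrystallographic] (w : P.weylGroup)
    (x : weightLattice P) : weightLattice P :=
  ⟨w • (x : V), weyl_smul_mem P w x.2⟩

/-- The coweight lattice `P^∨`, as a subgroup of `V`. -/
def coweightLattice (P : RootPairing ι ℝ V N) : AddSubgroup V where
  carrier := {a | ∀ i, ∃ n : ℤ, inner ℝ a (P.root i) = (n : ℝ)}
  zero_mem' i := ⟨0, by simp⟩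
  add_mem' {x y} hx hy i := by
    obtain ⟨m, hm⟩ := hx i
    obtain ⟨n, hn⟩ := hy i
    exact ⟨m + n, by rw [inner_add_left, hm, hn]; push_cast; rfl⟩
  neg_mem' {x} hx i := by
    obtain ⟨m, hm⟩ := hx i
    exact ⟨-m, by rw [inner_neg_left, hm]; push_cast; rfl⟩

/-- The lattice of translations in the extended affine Weyl group: `P^∨` in the untwisted
setting and `P` in the twisted setting. -/
def translationLattice (P : RootPairing ι ℝ V N) : Setting → AddSubgroup V
  | .untwisted => coweightLattice P
  | .twisted => weightLattice P

variable {P : RootPairing ι ℝ V N}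

/-- Dominance of a weight. -/
def IsDominant (Δ : P.Base) (x : weightLattice P) : Prop :=
  ∀ i ∈ Δ.support, 0 ≤ P.coroot' i (x : V)

/-- Antidominance of a weight. -/
def IsAntidominant (Δ : P.Base) (x : weightLattice P) : Prop :=
  ∀ i ∈ Δ.support, P.coroot' i (x : V) ≤ 0

/-- `θ` is the maximal root in the untwisted setting, and the maximal short root in the twisted
setting: for every (short) root `β`, `θ - β` is a sum of simple roots. If all roots have the
same length, they all count as short. -/
def IsTheta (Δ : P.Base) : Setting → V → Prop
  | .untwisted, θ => ∃ i, θ = P.root i ∧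
      ∀ j, P.root i - P.root j ∈ AddSubmonoid.closure (P.root '' Δ.support)
  | .twisted, θ => ∃ i, θ = P.root i ∧ (∀ k, ‖P.root i‖ ≤ ‖P.root k‖) ∧
      ∀ j, (∀ k, ‖P.root j‖ ≤ ‖P.root k‖) →
        P.root i - P.root j ∈ AddSubmonoid.closure (P.root '' Δ.support)

/-- The spacing of the imaginary parts of the affine roots over the root `α`: it is `1` in the
untwisted setting and `ν_α = (α, α) / 2` in the twisted setting. -/
def spacing (P : RootPairing ι ℝ V N) : Setting → ι → ℝ
  | .untwisted, _ => 1
  | .twisted, i => inner ℝ (P.root i) (P.root i) / 2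

/-- The positive affine roots: `[α, ν j]` with `j > 0`, or `j = 0` and `α > 0`. The negative
ones are their opposites. -/
def positiveAffineRoots (Δ : P.Base) (S : Setting) : Set (V × ℝ) :=
  {z | ∃ (i : ι) (j : ℤ), z = (P.root i, spacing P S i * j) ∧ (0 < j ∨ j = 0 ∧ Δ.IsPos i)}

/-- The simple affine roots: `α_0 = [-θ, 1]` (index `none`) and the `[α_i, 0]` for the simple
roots `α_i` (index `some i`). -/
def simpleAffineRoot (Δ : P.Base) (θ : V) : Option Δ.support → V × ℝ
  | none => (-θ, 1)
  | some i => (P.root i, 0)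

/-- The length `l(ŵ)`: the number of positive affine roots that `ŵ` sends to negative ones. -/
def length (Δ : P.Base) (S : Setting) (g : Module.End ℝ (V × ℝ)) : ℕ :=
  {z | z ∈ positiveAffineRoots Δ S ∧ -(g z) ∈ positiveAffineRoots Δ S}.ncard

/-- The Weyl group acting on `V × ℝ` through the first factor. -/
def ofWeyl (w : P.weylGroup) : Module.End ℝ (V × ℝ) :=
  (DistribSMul.toLinearMap ℝ V w).prodMap LinearMap.id

/-- `w₀` is the longest element of the Weyl group. -/
def IsLongest (Δ : P.Base) (S : Setting) (w₀ : P.weylGroup) : Prop :=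
  ∀ w : P.weylGroup, length Δ S (ofWeyl w) ≤ length Δ S (ofWeyl w₀)

/-- The extended affine Weyl group `Ŵ`: the transformations `w a`, for `w` in the Weyl group and
`a` in the lattice of translations. -/
def extendedAffineWeyl (P : RootPairing ι ℝ V N) (S : Setting) : Set (Module.End ℝ (V × ℝ)) :=
  {g | ∃ w : P.weylGroup, ∃ a ∈ translationLattice P S, g = ofWeyl w * translation a}

/-- The group `Π` of the elements `π_r`: the elements of `Ŵ` that permute the simple affine
roots. -/
def PiGroup (Δ : P.Base) (S : Setting) (θ : V) : Set (Module.End ℝ (V × ℝ)) :=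
  {g | g ∈ extendedAffineWeyl P S ∧
    g '' Set.range (simpleAffineRoot Δ θ) = Set.range (simpleAffineRoot Δ θ)}

/-- `ŵ = π_r s_{i_l} ⋯ s_{i_1}` is a reduced decomposition; here `word` is the list
`[i_l, …, i_1]`. -/
structure IsReducedDecomposition (Δ : P.Base) (S : Setting) (θ : V)
    (g : Module.End ℝ (V × ℝ)) (π : Module.End ℝ (V × ℝ)) (word : List (Option Δ.support)) :
    Prop where
  mem_pi : π ∈ PiGroup Δ S θ
  prod_eq : g = π * (word.map fun i ↦ affineReflection (simpleAffineRoot Δ θ i)).prod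
  length_eq : word.length = length Δ S g

/-- The product `π_r 𝕋_{i_l} ⋯ 𝕋_{i_1}` attached to a decomposition `π_r s_{i_l} ⋯ s_{i_1}`. -/
def TProduct (Δ : P.Base) (θ : V) (π : Module.End ℝ (V × ℝ)) (word : List (Option Δ.support))
    (f : LaurentRing V) : LaurentRing V :=
  monomialAction π (word.foldr (fun i h ↦ T (simpleAffineRoot Δ θ i) h) f)

open Classical in
/-- The half-sum of the positive coroots `α^∨ = 2 α / (α, α)` in the untwisted setting, and
the half-sum of the positive roots in the twisted setting. -/
def rhoCheck (Δ : P.Base) : Setting → V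
  | .untwisted => (1 / 2 : ℝ) • ∑ i with Δ.IsPos i,
      (2 / inner ℝ (P.root i) (P.root i) : ℝ) • P.root i
  | .twisted => (1 / 2 : ℝ) • ∑ i with Δ.IsPos i, P.root i

/-- The element `π_ρ = ρ̌ w₀` of the extended affine Weyl group. -/
def piRho (Δ : P.Base) (S : Setting) (w₀ : P.weylGroup) : Module.End ℝ (V × ℝ) :=
  translation (rhoCheck Δ S) * ofWeyl w₀

/-- The orbit sum `M_b`, the sum of `X_c` over the Weyl orbit of `b`. -/
def orbitSum (P : RootPairing ι ℝ V N) (b : V) : LaurentRing V :=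
  ∑ᶠ c ∈ MulAction.orbit P.weylGroup b, X (c, 0)

/-- The extremal dag-polynomial `𝔼†_b = q^{(ρ̌, b)} 𝔗(M_b)`, where
`𝔗 = π_r 𝕋_{i_l} ⋯ 𝕋_{i_1}` is computed from a decomposition of `π_ρ`. -/
def dagPolynomial (Δ : P.Base) (S : Setting) (θ : V) (π : Module.End ℝ (V × ℝ))
    (word : List (Option Δ.support)) (b : V) : LaurentRing V :=
  X (0, inner ℝ (rhoCheck Δ S) b) * TProduct Δ θ π word (orbitSum P b)

/-- The system of exponents `c ↦ e_c`, defined by `𝔼†_b = ∑_{c ∈ W(b)} q^{-e_c} X_c` for all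
antidominant weights `b` and whichever reduced decomposition of `π_ρ` is used. (Every weight `c`
lies in the orbit of exactly one antidominant `b`.) -/
def IsDagExponent (Δ : P.Base) (S : Setting) (θ : V) (w₀ : P.weylGroup)
    (e : weightLattice P → ℕ) : Prop :=
  ∀ (π : Module.End ℝ (V × ℝ)) (word : List (Option Δ.support)),
    IsReducedDecomposition Δ S θ (piRho Δ S w₀) π word →
    ∀ b : weightLattice P, IsAntidominant Δ b →
      dagPolynomial Δ S θ π word (b : V) =
        ∑ᶠ (c : weightLattice P) (_ : (c : V) ∈ MulAction.orbit P.weylGroup (b : V)),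
          X ((c : V), -(e c : ℝ))

/-- The extremal dag-degree `e(b, w) = e_{w(-b)}` of a dominant weight `b`. -/
def dagDegree [P.IsCrystallographic] (e : weightLattice P → ℕ) (b : weightLattice P)
    (w : P.weylGroup) : ℕ :=
  e (weylAct P w (-b))

end RootSystem

end ExtremalDag

end

/-! Each `T α` preserves the shape "one monomial `q^{a(c)} X_c` over every point `c` of a Weyl
orbit": the coefficient of `T α F` at `z` is that of `F` at the image of `z` under folding along the
wall of `α` (`coeff_T`, `T_sectionSum`). Applying a word to an orbit sum therefore amounts to
iterating `foldHeight` on a single function on `V`, the same for all orbits; `Π` only transports it.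

Independence of the reduced word. For a reduced word with product `g`, the exponent over `c` is the
largest `ζ` such that `v(d, 0) = (c, ζ)` for some `v ≤ g` in the Bruhat order and some `d` in the
orbit (`isGreatest_wordHeight`). This description involves only `g`. The induction rests on the
lifting property of the Bruhat order and on `exists_le_reflect`: from the side of the wall where
`(c, α_i) ≥ 0` one can pass to the reflected point without leaving the elements below `h` and
without dropping below the reflected height.

Integrality and sign. Climbing from `v` to `ρ̌ w₀` in the Bruhat order, heights change by integers
and can be chosen not to decrease. At `ρ̌ w₀` they have the form `-(ρ̌, x)` with `x` in the orbit of
`b`, and the antidominant `b` minimizes `(ρ̌, ·)` there. After the shift by `(ρ̌, b)` all exponents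
are thus integers `≤ 0` (`exists_nat_of_bruhatLE_piRho`).

Additivity. At a point `w • x` with `x` antidominant, the side of the wall of `α` is governed by the
sign of the root `w⁻¹α`, independently of `x`, and the two branches agree on the wall. For fixed `w`
every folding step uses one branch, additive in `x` (`wordHeight_add`). -/

noncomputable section

set_option linter.unusedSectionVars false

namespace ExtremalDag

/-! ### Finite root systems: the invariant form, `ρ̌`, integrality, and `θ`. -/

section FiniteRootSystem

variable {ι V N : Type*} [Fintype ι] [NormedAddCommGroup V] [InnerProductSpace ℝ V]
  [AddCommGroup N] [Module ℝ N] {P : RootPairing ι ℝ V N}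

theorem inner_root_self_pos (P : RootPairing ι ℝ V N) (i : ι) :
    (0 : ℝ) < inner ℝ (P.root i) (P.root i) :=
  real_inner_self_pos.2 (P.ne_zero i)

theorem corootPairing_mul_inner_self (x : V) (i : ι) :
    corootPairing x (P.root i) * inner ℝ (P.root i) (P.root i) = 2 * inner ℝ x (P.root i) := by
  have := inner_root_self_pos P i
  rw [corootPairing]; field_simp

theorem corootPairing_nonneg_iff (x : V) (i : ι) :
    0 ≤ corootPairing x (P.root i) ↔ 0 ≤ inner ℝ x (P.root i) := by
  have h := inner_root_self_pos P i
  have h' := corootPairing_mul_inner_self x i (P := P)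
  constructor <;> intro H <;> nlinarith

theorem corootPairing_nonpos_iff (x : V) (i : ι) :
    corootPairing x (P.root i) ≤ 0 ↔ inner ℝ x (P.root i) ≤ 0 := by
  have h := inner_root_self_pos P i
  have h' := corootPairing_mul_inner_self x i (P := P)
  constructor <;> intro H <;> nlinarith

namespace IsNormalizedForm

variable (hP : IsNormalizedForm P)
include hP

theorem reflection_apply (i : ι) (x : V) :
    P.reflection i x = x - corootPairing x (P.root i) • P.root i := by
  rw [P.reflection_apply, ← hP.coroot_eq]

theorem inner_smul_smul (w : P.weylGroup) (x y : V) :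
    inner ℝ (w • x) (w • y) = (inner ℝ x y : ℝ) := by
  obtain ⟨g, hg⟩ := w
  induction hg using RootPairing.weylGroup.induction generalizing x y with
  | mem i =>
    have h (z : V) : (⟨RootPairing.Equiv.reflection P i, P.reflection_mem_weylGroup i⟩ :
      P.weylGroup) • z = P.reflection i z := rfl
    have h1 := corootPairing_mul_inner_self x i (P := P)
    have h2 := corootPairing_mul_inner_self y i (P := P)
    rw [h, h, hP.reflection_apply, hP.reflection_apply]
    simp only [inner_sub_left, inner_sub_right, real_inner_smul_left, real_inner_smul_right]
    rw [real_inner_comm y (P.root i)]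
    linear_combination (corootPairing x (P.root i) / 2) * h2 + (corootPairing y (P.root i) / 2) * h1
  | one => rfl
  | mul g₁ g₂ h₁ h₂ ih₁ ih₂ =>
    rw [← Submonoid.mk_mul_mk _ g₁ g₂ h₁ h₂, mul_smul, mul_smul, ih₁, ih₂]

theorem corootPairing_smul_smul (w : P.weylGroup) (x y : V) :
    corootPairing (w • x) (w • y) = corootPairing x y := by
  simp only [corootPairing, hP.inner_smul_smul]

theorem exists_int_pairing [P.IsCrystallographic] (i j : ι) :
    ∃ n : ℤ, corootPairing (P.root i) (P.root j) = n := by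
  obtain ⟨k, hk⟩ := P.exists_value (S := ℤ) i j
  exact ⟨k, by rw [← hP.coroot_eq, P.root_coroot'_eq_pairing, ← hk]; rfl⟩

end IsNormalizedForm

/-- The image of a root under an element of the Weyl group is a root. -/
theorem exists_root_eq_weyl_smul (w : P.weylGroup) (i : ι) : ∃ j, w • P.root i = P.root j :=
  ⟨_, P.weylGroup_apply_root w i⟩

theorem ofIdx_smul_eq (i : ι) (x : V) : RootPairing.weylGroup.ofIdx P i • x = P.reflection i x :=
  rfl

theorem exists_root_eq_neg (P : RootPairing ι ℝ V N) (i : ι) : ∃ j, P.root j = -P.root i :=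
  ⟨P.reflectionPerm i i, by simp⟩

theorem IsPos.not_of_root_eq_neg {Δ : P.Base} {i j : ι} (h : P.root j = -P.root i) :
    Δ.IsPos j ↔ ¬ Δ.IsPos i := by
  let := P.indexNeg
  have : j = -i := P.root.injective (by simpa using h)
  rw [this]; exact RootPairing.Base.IsPos.neg_iff_not Δ i

theorem inner_nonneg_of_mem_closure {Δ : P.Base} {x z : V}
    (hx : ∀ i ∈ Δ.support, 0 ≤ (inner ℝ x (P.root i) : ℝ))
    (hz : z ∈ AddSubmonoid.closure (P.root '' Δ.support)) : 0 ≤ (inner ℝ x z : ℝ) := by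
  induction hz using AddSubmonoid.closure_induction with
  | mem y hy => obtain ⟨i, hi, rfl⟩ := hy; exact hx i hi
  | zero => simp
  | add a b _ _ ha hb => rw [inner_add_right]; exact add_nonneg ha hb

/-- Used with `x = ρ̌` to conclude `θ = β` from `(ρ̌, θ - β) = 0`. The induction runs on the
dichotomy "zero or strictly positive", because vanishing of the sum is not a property that the
summands inherit directly. -/
theorem eq_zero_of_mem_closure {Δ : P.Base} {x z : V}
    (hx : ∀ i ∈ Δ.support, 0 < (inner ℝ x (P.root i) : ℝ))
    (hz : z ∈ AddSubmonoid.closure (P.root '' Δ.support)) (h : (inner ℝ x z : ℝ) = 0) : z = 0 := by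
  have key : z = 0 ∨ 0 < (inner ℝ x z : ℝ) := by
    clear h
    induction hz using AddSubmonoid.closure_induction with
    | mem y hy => obtain ⟨i, hi, rfl⟩ := hy; exact Or.inr (hx i hi)
    | zero => simp
    | add a b _ _ ha hb =>
      rw [inner_add_right]
      rcases ha with rfl | ha
      · simpa using hb
      · rcases hb with rfl | hb
        · right; simpa using ha
        · right; exact add_pos ha hb
  exact key.resolve_right h.not_gt

variable [P.IsCrystallographic]

theorem inner_nonneg_of_isPos {Δ : P.Base} {x : V}
    (hx : ∀ i ∈ Δ.support, 0 ≤ (inner ℝ x (P.root i) : ℝ)) {i : ι} (hi : Δ.IsPos i) :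
    0 ≤ (inner ℝ x (P.root i) : ℝ) := by
  refine hi.induction_on_add (p := fun i ↦ 0 ≤ (inner ℝ x (P.root i) : ℝ)) hx
    fun i j k hk hi hj ↦ ?_
  rw [hk, inner_add_right]
  exact add_nonneg hi (hx j hj)

theorem inner_pos_of_isPos {Δ : P.Base} {x : V}
    (hx : ∀ i ∈ Δ.support, 0 < (inner ℝ x (P.root i) : ℝ)) {i : ι} (hi : Δ.IsPos i) :
    0 < (inner ℝ x (P.root i) : ℝ) := by
  refine hi.induction_on_add (p := fun i ↦ 0 < (inner ℝ x (P.root i) : ℝ)) hx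
    fun i j k hk hi hj ↦ ?_
  rw [hk, inner_add_right]
  exact add_pos hi (hx j hj)

/-- The coefficient of the root `α` in `2ρ̌`. -/
def rhoCoeff (P : RootPairing ι ℝ V N) : Setting → ι → ℝ
  | .untwisted, i => 2 / inner ℝ (P.root i) (P.root i)
  | .twisted, _ => 1

theorem rhoCoeff_pos (P : RootPairing ι ℝ V N) (S : Setting) (i : ι) : 0 < rhoCoeff P S i := by
  have := inner_root_self_pos P i
  cases S <;> simp only [rhoCoeff] <;> positivity

open Classical in
theorem rhoCheck_eq (Δ : P.Base) (S : Setting) :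
    rhoCheck Δ S = (1 / 2 : ℝ) • ∑ i with Δ.IsPos i, rhoCoeff P S i • P.root i := by
  cases S <;> simp [rhoCheck, rhoCoeff]

theorem rhoCoeff_congr {S : Setting} {i j : ι}
    (h : (inner ℝ (P.root i) (P.root i) : ℝ) = inner ℝ (P.root j) (P.root j)) :
    rhoCoeff P S i = rhoCoeff P S j := by
  cases S <;> simp only [rhoCoeff, h]

theorem spacing_congr {S : Setting} {i j : ι}
    (h : (inner ℝ (P.root i) (P.root i) : ℝ) = inner ℝ (P.root j) (P.root j)) :
    spacing P S i = spacing P S j := by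
  cases S <;> simp only [spacing, h]

theorem spacing_pos (P : RootPairing ι ℝ V N) (S : Setting) (i : ι) : 0 < spacing P S i := by
  have := inner_root_self_pos P i
  cases S <;> simp only [spacing] <;> positivity

namespace IsNormalizedForm

variable (hP : IsNormalizedForm P)
include hP

theorem inner_root_eq_of_smul_eq {w : P.weylGroup} {i j : ι} (h : w • P.root i = P.root j) :
    (inner ℝ (P.root j) (P.root j) : ℝ) = inner ℝ (P.root i) (P.root i) := by
  rw [← h, hP.inner_smul_smul]

theorem inner_root_reflectionPerm (i j : ι) :
    (inner ℝ (P.root (P.reflectionPerm j i)) (P.root (P.reflectionPerm j i)) : ℝ) =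
      inner ℝ (P.root i) (P.root i) :=
  hP.inner_root_eq_of_smul_eq (w := RootPairing.weylGroup.ofIdx P j)
    (by rw [ofIdx_smul_eq, P.root_reflectionPerm])

-- The simple reflection `s_j` permutes the positive roots other than `α_j`, and the coefficients in
-- `2ρ̌` depend only on root lengths. So `s_j` moves `ρ̌` only through its `α_j` term, and
-- comparison with the reflection formula gives the pairing.
open Classical in
theorem corootPairing_rhoCheck [P.IsReduced] (Δ : P.Base) (S : Setting) {j : ι}
    (hj : j ∈ Δ.support) : corootPairing (rhoCheck Δ S) (P.root j) = rhoCoeff P S j := by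
  have hjp : Δ.IsPos j := RootPairing.Base.isPos_of_mem_support hj
  set f : ι → V := fun i ↦ rhoCoeff P S i • P.root i with hf
  have hs : ∑ i with Δ.IsPos i, f i = f j + ∑ i with Δ.IsPos i ∧ i ≠ j, f i := by
    rw [← Finset.add_sum_erase _ f (a := j) (by simpa)]
    congr 1
    refine Finset.sum_congr ?_ fun _ _ ↦ rfl
    ext i; simp [and_comm]
  have hmem (i : ι) (hi : Δ.IsPos i ∧ i ≠ j) :
      Δ.IsPos (P.reflectionPerm j i) ∧ P.reflectionPerm j i ≠ j := by
    have h1 := hi.1.reflectionPerm hj hi.2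
    refine ⟨h1, fun h ↦ ?_⟩
    have h2 : P.root i = -P.root j := by
      have := congrArg (fun k ↦ P.root (P.reflectionPerm j k)) h
      simpa using this
    exact (IsPos.not_of_root_eq_neg h2).1 hi.1 hjp
  have hrefl : P.reflection j (∑ i with Δ.IsPos i ∧ i ≠ j, f i) =
      ∑ i with Δ.IsPos i ∧ i ≠ j, f i := by
    rw [map_sum]
    refine Finset.sum_nbij' (P.reflectionPerm j) (P.reflectionPerm j) ?_ ?_ ?_ ?_ ?_
    · intro i hi
      simpa using hmem i (by simpa using hi)
    · intro i hi
      simpa using hmem i (by simpa using hi)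
    · simp
    · simp
    · intro i hi
      simp only [hf, map_smul, P.root_reflectionPerm]
      rw [rhoCoeff_congr (hP.inner_root_reflectionPerm i j)]
  have h2 : P.reflection j (rhoCheck Δ S) = rhoCheck Δ S - rhoCoeff P S j • P.root j := by
    rw [rhoCheck_eq, map_smul, hs, map_add, hrefl]
    simp only [hf, map_smul, P.reflection_apply_self]
    module
  rw [hP.reflection_apply] at h2
  have h3 := sub_right_injective h2
  exact smul_left_injective ℝ (P.ne_zero j) h3

theorem inner_rhoCheck_pos [P.IsReduced] (Δ : P.Base) (S : Setting) {j : ι}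
    (hj : j ∈ Δ.support) : 0 < (inner ℝ (rhoCheck Δ S) (P.root j) : ℝ) := by
  have h := corootPairing_mul_inner_self (rhoCheck Δ S) j (P := P)
  rw [hP.corootPairing_rhoCheck Δ S hj] at h
  have := rhoCoeff_pos P S j
  have := inner_root_self_pos P j
  nlinarith [mul_pos (rhoCoeff_pos P S j) (inner_root_self_pos P j)]

theorem inner_rhoCheck_simple [P.IsReduced] (Δ : P.Base) (S : Setting) {j : ι}
    (hj : j ∈ Δ.support) : (inner ℝ (rhoCheck Δ S) (P.root j) : ℝ) = spacing P S j := by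
  have h := corootPairing_mul_inner_self (rhoCheck Δ S) j (P := P)
  rw [hP.corootPairing_rhoCheck Δ S hj] at h
  have := (inner_root_self_pos P j).ne'
  cases S
  · simp only [rhoCoeff] at h
    simp only [spacing]; field_simp at h; linarith
  · simp only [rhoCoeff] at h
    simp only [spacing]; linarith

theorem eq_zero_of_forall_inner_eq_zero [P.IsRootSystem] {x : V}
    (h : ∀ i, (inner ℝ x (P.root i) : ℝ) = 0) : x = 0 := by
  rw [P.eq_zero_iff_forall_coroot'_eq_zero]
  intro i
  rw [hP.coroot_eq, corootPairing, h i]; simp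

/-- The roots of minimal length span the whole space. -/
theorem eq_zero_of_forall_short [P.IsRootSystem] [P.IsIrreducible] {x : V}
    (h : ∀ i, (∀ k, ‖P.root i‖ ≤ ‖P.root k‖) → (inner ℝ x (P.root i) : ℝ) = 0) : x = 0 := by
  have : Nontrivial V := RootPairing.IsIrreducible.nontrivial P
  have hne : Nonempty ι := by
    by_contra hι
    rw [not_nonempty_iff] at hι
    obtain ⟨y, hy⟩ := exists_ne (0 : V)
    exact hy (hP.eq_zero_of_forall_inner_eq_zero fun i ↦ hι.elim i)
  obtain ⟨i₀, hi₀⟩ := Finite.exists_min fun i ↦ ‖P.root i‖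
  let Q : Submodule ℝ V := Submodule.span ℝ {y | ∃ i, (∀ k, ‖P.root i‖ ≤ ‖P.root k‖) ∧ y = P.root i}
  have hQ : Q = ⊤ := by
    refine RootPairing.IsIrreducible.eq_top_of_invtSubmodule_reflection (P := P) Q (fun j ↦ ?_) ?_
    · rw [Module.End.mem_invtSubmodule, ← Submodule.map_le_iff_le_comap, Submodule.map_span,
        Submodule.span_le]
      rintro - ⟨-, ⟨i, hi, rfl⟩, rfl⟩
      refine Submodule.subset_span ⟨P.reflectionPerm j i, fun k ↦ ?_, ?_⟩
      · have := hP.inner_root_reflectionPerm i j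
        rw [real_inner_self_eq_norm_sq, real_inner_self_eq_norm_sq] at this
        rw [(pow_left_inj₀ (norm_nonneg _) (norm_nonneg _) two_ne_zero).1 this]
        exact hi k
      · exact (P.root_reflectionPerm j i).symm
    · intro hbot
      have : P.root i₀ ∈ Q := Submodule.subset_span ⟨i₀, hi₀, rfl⟩
      rw [hbot] at this
      exact P.ne_zero i₀ (by simpa using this)
  have hx : x ∈ Q := by rw [hQ]; trivial
  have hle : Q ≤ LinearMap.ker (innerₛₗ ℝ x) := by
    rw [Submodule.span_le]
    rintro - ⟨i, hi, rfl⟩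
    simpa using h i hi
  have := hle hx
  simpa using this

/-- `ν_α` is an integer. -/
theorem exists_int_nu [P.IsRootSystem] [P.IsReduced] [P.IsIrreducible] (i : ι) :
    ∃ n : ℤ, (inner ℝ (P.root i) (P.root i) : ℝ) / 2 = n := by
  -- Short roots span, so some short root is not orthogonal to `α_i`; the rank-two subsystem they
  -- generate determines `ν`.
  obtain ⟨j, hj, hij⟩ : ∃ j, (∀ k, ‖P.root j‖ ≤ ‖P.root k‖) ∧
      (inner ℝ (P.root i) (P.root j) : ℝ) ≠ 0 := by
    by_contra! H
    exact P.ne_zero i (hP.eq_zero_of_forall_short H)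
  have hj2 := hP.short_eq_two j hj
  have hle : (2 : ℝ) ≤ inner ℝ (P.root i) (P.root i) := by
    rw [← hj2, real_inner_self_eq_norm_sq, real_inner_self_eq_norm_sq]
    exact pow_le_pow_left₀ (norm_nonneg _) (hj i) 2
  obtain ⟨m, hm⟩ := hP.exists_int_pairing i j
  obtain ⟨n, hn⟩ := hP.exists_int_pairing j i
  have h1 := corootPairing_mul_inner_self (P.root i) j (P := P)
  have h2 := corootPairing_mul_inner_self (P.root j) i (P := P)
  rw [hm, hj2] at h1
  rw [hn, real_inner_comm (P.root i) (P.root j)] at h2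
  have hmn : (n : ℝ) * inner ℝ (P.root i) (P.root i) = 2 * m := by linarith
  have hm0 : (m : ℝ) ≠ 0 := fun h ↦ hij (by rw [h] at h1; linarith)
  have hn0 : (n : ℝ) ≠ 0 := fun h ↦ hm0 (by rw [h] at hmn; linarith)
  -- Here `m = n ν` with `ν ≥ 1`, and Cauchy–Schwarz gives `m n ≤ 4`. Hence `n² ≤ m n ≤ 4`, and `n =
  -- ±2` forces `m = n`; in every case `n` divides `m`.
  have hcs : (m : ℝ) * n ≤ 4 := by
    have := real_inner_mul_inner_self_le (P.root i) (P.root j)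
    rw [hj2] at this
    have hm1 : (m : ℝ) = inner ℝ (P.root i) (P.root j) := by linarith
    have hpos := inner_root_self_pos P i
    have h3 : (m : ℝ) * (n * inner ℝ (P.root i) (P.root i)) ≤ 4 * inner ℝ (P.root i) (P.root i) := by
      rw [hmn]; rw [← hm1] at this; linarith
    nlinarith
  have hnn : (n : ℝ) * n ≤ m * n := by
    have : (m : ℝ) * n = n * n * (inner ℝ (P.root i) (P.root i) / 2) := by linear_combination (-n / 2 : ℝ) * hmn
    nlinarith [mul_self_nonneg (n : ℝ)]
  have hcs' : m * n ≤ 4 := by exact_mod_cast hcs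
  have hnn' : n * n ≤ m * n := by exact_mod_cast hnn
  have hn0' : n ≠ 0 := by exact_mod_cast hn0
  have hn1 : n ≤ 2 := by nlinarith
  have hn2 : -2 ≤ n := by nlinarith
  obtain ⟨k, hk⟩ : ∃ k : ℤ, m = n * k := by
    have : n = -2 ∨ n = -1 ∨ n = 1 ∨ n = 2 := by omega
    rcases this with rfl | rfl | rfl | rfl
    · exact ⟨1, by omega⟩
    · exact ⟨-m, by ring⟩
    · exact ⟨m, by ring⟩
    · exact ⟨1, by omega⟩
  refine ⟨k, ?_⟩
  rw [hk] at hmn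
  push_cast at hmn
  have : (n : ℝ) * (inner ℝ (P.root i) (P.root i) - 2 * k) = 0 := by linarith
  rcases mul_eq_zero.1 this with h | h
  · exact absurd h hn0
  · linarith

theorem exists_int_spacing [P.IsRootSystem] [P.IsReduced] [P.IsIrreducible] (S : Setting) (i : ι) :
    ∃ n : ℤ, spacing P S i = n := by
  cases S
  · exact ⟨1, by simp [spacing]⟩
  · exact hP.exists_int_nu i

/-- In the twisted setting both sides equal `(α_i, α_j)`, by symmetry of the form. With `j` the
index of `θ`, this says that `s_0` shifts imaginary parts by whole multiples of the spacing. -/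
theorem exists_int_pairing_mul_spacing (S : Setting) (i j : ι) :
    ∃ n : ℤ, corootPairing (P.root i) (P.root j) * spacing P S j = spacing P S i * n := by
  cases S
  · simpa [spacing] using hP.exists_int_pairing i j
  · obtain ⟨n, hn⟩ := hP.exists_int_pairing j i
    refine ⟨n, ?_⟩
    have h1 := corootPairing_mul_inner_self (P.root i) j (P := P)
    have h2 := corootPairing_mul_inner_self (P.root j) i (P := P)
    rw [hn, real_inner_comm (P.root i) (P.root j)] at h2
    simp only [spacing]
    linarith

theorem exists_int_inner_translation {S : Setting} {a : V} (ha : a ∈ translationLattice P S)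
    (i : ι) : ∃ n : ℤ, (inner ℝ (P.root i) a : ℝ) = spacing P S i * n := by
  cases S
  · obtain ⟨n, hn⟩ := ha i
    exact ⟨n, by rw [real_inner_comm, hn]; simp [spacing]⟩
  · obtain ⟨n, hn⟩ := ha i
    refine ⟨n, ?_⟩
    have h1 := corootPairing_mul_inner_self a i (P := P)
    rw [← hP.coroot_eq, hn] at h1
    rw [real_inner_comm]
    simp only [spacing]
    linarith

/-- The vector is `ν k α^∨`, where `ν` is the spacing: the translation part of the reflection in
`[α, ν k]`. -/
theorem smul_root_mem_translationLattice (S : Setting) (i : ι) (k : ℤ) :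
    (spacing P S i * k * 2 / inner ℝ (P.root i) (P.root i)) • P.root i ∈
      translationLattice P S := by
  have h0 := (inner_root_self_pos P i).ne'
  cases S
  · intro j
    obtain ⟨n, hn⟩ := hP.exists_int_pairing j i
    refine ⟨k * n, ?_⟩
    push_cast
    rw [← hn, real_inner_smul_left, corootPairing, real_inner_comm (P.root j) (P.root i)]
    simp only [spacing]; ring
  · intro j
    obtain ⟨n, hn⟩ := hP.exists_int_pairing i j
    refine ⟨k * n, ?_⟩
    push_cast
    rw [map_smul, hP.coroot_eq, hn, smul_eq_mul]
    simp only [spacing]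
    field_simp

theorem smul_mem_translationLattice (w : P.weylGroup) {S : Setting} {a : V}
    (ha : a ∈ translationLattice P S) : w • a ∈ translationLattice P S := by
  cases S
  · intro i
    obtain ⟨j, hj⟩ := exists_root_eq_weyl_smul w⁻¹ i
    obtain ⟨n, hn⟩ := ha j
    refine ⟨n, ?_⟩
    rw [← hn, ← hj, ← hP.inner_smul_smul w a, smul_inv_smul]
  · exact weyl_smul_mem P w ha

/-- Integrality is checked on simple roots (untwisted) or simple coroots (twisted), where the
pairing is 1; every root or coroot is, up to sign, a sum of simple ones. -/
theorem rhoCheck_mem_translationLattice [P.IsReduced] (Δ : P.Base) (S : Setting) :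
    rhoCheck Δ S ∈ translationLattice P S := by
  cases S
  · intro i
    have key : ∀ z ∈ AddSubmonoid.closure (P.root '' Δ.support),
        ∃ n : ℤ, (inner ℝ (rhoCheck Δ .untwisted) z : ℝ) = n := by
      intro z hz
      induction hz using AddSubmonoid.closure_induction with
      | mem y hy =>
        obtain ⟨j, hj, rfl⟩ := hy
        exact ⟨1, by rw [hP.inner_rhoCheck_simple Δ _ hj]; simp [spacing]⟩
      | zero => exact ⟨0, by simp⟩
      | add a b _ _ ha hb =>
        obtain ⟨m, hm⟩ := ha
        obtain ⟨n, hn⟩ := hb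
        exact ⟨m + n, by rw [inner_add_right, hm, hn]; push_cast; rfl⟩
    rcases Δ.root_mem_or_neg_mem i with h | h
    · exact key _ h
    · obtain ⟨n, hn⟩ := key _ h
      exact ⟨-n, by rw [inner_neg_right] at hn; push_cast; linarith⟩
  · intro i
    have key : ∀ z ∈ AddSubmonoid.closure (P.coroot '' Δ.support),
        ∃ n : ℤ, P.toLinearMap (rhoCheck Δ .twisted) z = n := by
      intro z hz
      induction hz using AddSubmonoid.closure_induction with
      | mem y hy =>
        obtain ⟨j, hj, rfl⟩ := hy
        refine ⟨1, ?_⟩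
        have := hP.corootPairing_rhoCheck Δ .twisted hj
        rw [← hP.coroot_eq] at this
        simpa [rhoCoeff] using this
      | zero => exact ⟨0, by simp⟩
      | add a b _ _ ha hb =>
        obtain ⟨m, hm⟩ := ha
        obtain ⟨n, hn⟩ := hb
        exact ⟨m + n, by rw [map_add, hm, hn]; push_cast; rfl⟩
    rcases Δ.coroot_mem_or_neg_mem i with h | h
    · exact key _ h
    · obtain ⟨n, hn⟩ := key _ h
      refine ⟨-n, ?_⟩
      rw [map_neg] at hn
      push_cast
      rw [← hn, neg_neg]
      rfl

theorem exists_int_inner_rhoCheck_root [P.IsRootSystem] [P.IsReduced] [P.IsIrreducible]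
    (Δ : P.Base) (S : Setting) (i : ι) : ∃ n : ℤ, (inner ℝ (rhoCheck Δ S) (P.root i) : ℝ) = n := by
  obtain ⟨m, hm⟩ := hP.exists_int_inner_translation (hP.rhoCheck_mem_translationLattice Δ S) i
  obtain ⟨n, hn⟩ := hP.exists_int_spacing S i
  exact ⟨n * m, by rw [real_inner_comm, hm, hn]; push_cast; rfl⟩

/-- A reflection changes a weight by an integer multiple of a root, and `ρ̌` is integral on roots.
Only differences are claimed, since `(ρ̌, b)` itself may be fractional. -/
theorem exists_int_inner_rhoCheck_smul_sub [P.IsRootSystem] [P.IsReduced] [P.IsIrreducible]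
    (Δ : P.Base) (S : Setting) {b : V} (hb : b ∈ weightLattice P) (w : P.weylGroup) :
    ∃ n : ℤ, (inner ℝ (rhoCheck Δ S) (w • b) : ℝ) - inner ℝ (rhoCheck Δ S) b = n := by
  obtain ⟨g, hg⟩ := w
  induction hg using RootPairing.weylGroup.induction generalizing b with
  | mem i =>
    obtain ⟨m, hm⟩ := hb i
    obtain ⟨n, hn⟩ := hP.exists_int_inner_rhoCheck_root Δ S i
    refine ⟨-(m * n), ?_⟩
    have h : (⟨RootPairing.Equiv.reflection P i, P.reflection_mem_weylGroup i⟩ : P.weylGroup) • b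
        = P.reflection i b := rfl
    rw [h, P.reflection_apply, inner_sub_right, real_inner_smul_right, hm, hn]
    push_cast; ring
  | one => exact ⟨0, by simp [← Submonoid.one_def]⟩
  | mul g₁ g₂ h₁ h₂ ih₁ ih₂ =>
    rw [← Submonoid.mk_mul_mk _ g₁ g₂ h₁ h₂, mul_smul]
    obtain ⟨m, hm⟩ := ih₁ (weyl_smul_mem P ⟨g₂, h₂⟩ hb)
    obtain ⟨n, hn⟩ := ih₂ hb
    exact ⟨m + n, by push_cast; linarith⟩

open Classical in
/-- The minimum of `(ρ̌, ·)` over a Weyl orbit is attained at the antidominant element. -/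
theorem inner_rhoCheck_le_smul (Δ : P.Base) (S : Setting) {b : V}
    (hb : ∀ i ∈ Δ.support, (inner ℝ b (P.root i) : ℝ) ≤ 0) (w : P.weylGroup) :
    (inner ℝ (rhoCheck Δ S) b : ℝ) ≤ inner ℝ (rhoCheck Δ S) (w • b) := by
  have hb' (i : ι) (hi : Δ.IsPos i) : (inner ℝ (P.root i) b : ℝ) ≤ 0 := by
    have := inner_nonneg_of_isPos (x := -b) (fun i hi ↦ by
      rw [inner_neg_left]; have := hb i hi; linarith) hi
    rw [inner_neg_left, real_inner_comm] at this
    linarith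
  -- Replacing each `(α, x)` by `-|(α, x)|` gives a lower bound for `(ρ̌, x)`, attained at
  -- antidominant `x`. The bound is Weyl-invariant, being half of the corresponding sum over all
  -- roots.
  have hsum (x : V) : (inner ℝ (rhoCheck Δ S) x : ℝ) =
      1 / 2 * ∑ i with Δ.IsPos i, rhoCoeff P S i * inner ℝ (P.root i) x := by
    rw [rhoCheck_eq, real_inner_smul_left, sum_inner]
    simp only [real_inner_smul_left]
  have habs (x : V) : ∑ i with Δ.IsPos i, rhoCoeff P S i * |inner ℝ (P.root i) x| =
      1 / 2 * ∑ i, rhoCoeff P S i * |inner ℝ (P.root i) x| := by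
    have hinvol (i : ι) : P.reflectionPerm (P.reflectionPerm i i) (P.reflectionPerm i i) = i := by
      have hself (i : ι) : P.root (P.reflectionPerm i i) = -P.root i := by simp
      apply P.root.injective
      rw [hself, hself, neg_neg]
    have h1 : ∑ i with ¬ Δ.IsPos i, rhoCoeff P S i * |inner ℝ (P.root i) x| =
        ∑ i with Δ.IsPos i, rhoCoeff P S i * |inner ℝ (P.root i) x| := by
      refine Finset.sum_nbij' (fun i ↦ P.reflectionPerm i i) (fun i ↦ P.reflectionPerm i i)
        ?_ ?_ ?_ ?_ ?_
      · intro i hi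
        have : P.root (P.reflectionPerm i i) = -P.root i := by simp
        simpa [IsPos.not_of_root_eq_neg this] using hi
      · intro i hi
        have : P.root (P.reflectionPerm i i) = -P.root i := by simp
        simpa [IsPos.not_of_root_eq_neg this] using hi
      · intro i _
        exact hinvol i
      · intro i _
        exact hinvol i
      · intro i _
        rw [rhoCoeff_congr (hP.inner_root_reflectionPerm i i)]
        simp
    rw [← Finset.sum_filter_add_sum_filter_not Finset.univ Δ.IsPos, h1]
    ring
  have hinv : ∑ i, rhoCoeff P S i * |inner ℝ (P.root i) (w • b)| =
      ∑ i, rhoCoeff P S i * |inner ℝ (P.root i) b| := by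
    refine (Fintype.sum_equiv (P.weylGroupToPerm w) _ _ fun i ↦ ?_).symm
    rw [← P.weylGroup_apply_root, hP.inner_smul_smul]
    congr 1
    exact (rhoCoeff_congr (hP.inner_root_eq_of_smul_eq (P.weylGroup_apply_root w i))).symm
  rw [hsum, hsum]
  have h1 : ∑ i with Δ.IsPos i, rhoCoeff P S i * inner ℝ (P.root i) b =
      -∑ i with Δ.IsPos i, rhoCoeff P S i * |inner ℝ (P.root i) b| := by
    rw [← Finset.sum_neg_distrib]
    refine Finset.sum_congr rfl fun i hi ↦ ?_
    rw [abs_of_nonpos (hb' i (by simpa using hi))]; ring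
  have h2 : -∑ i with Δ.IsPos i, rhoCoeff P S i * |inner ℝ (P.root i) (w • b)| ≤
      ∑ i with Δ.IsPos i, rhoCoeff P S i * inner ℝ (P.root i) (w • b) := by
    rw [← Finset.sum_neg_distrib]
    refine Finset.sum_le_sum fun i _ ↦ ?_
    have := neg_abs_le (inner ℝ (P.root i) (w • b) : ℝ)
    nlinarith [rhoCoeff_pos P S i]
  rw [habs, hinv, ← habs] at h2
  linarith

end IsNormalizedForm

/-- The properties of `θ` that make `[-θ, 1]` a simple affine root. -/
structure IsAffineVertex (Δ : P.Base) (S : Setting) (t : ι) : Prop where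
  spacing_eq : spacing P S t = 1
  isPos : Δ.IsPos t
  dominant : ∀ i ∈ Δ.support, 0 ≤ (inner ℝ (P.root t) (P.root i) : ℝ)
  pairing_le : ∀ j, j ≠ t → corootPairing (P.root j) (P.root t) ≤ spacing P S j
  eq_zero : ∀ x : V, (∀ i ∈ Δ.support, 0 ≤ (inner ℝ x (P.root i) : ℝ)) →
    (inner ℝ x (P.root t) : ℝ) ≤ 0 → x = 0

/-- Maximality of `θ` is tested against suitable roots: `s_i θ` gives dominance and `-θ` gives
positivity. Pairing with `ρ̌`, which is strictly positive on simple roots, turns membership in the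
cone of simple roots into inequalities. -/
theorem IsTheta.exists_isAffineVertex [P.IsRootSystem] [P.IsReduced] [P.IsIrreducible]
    (hP : IsNormalizedForm P) {Δ : P.Base} {S : Setting} {θ : V} (hθ : IsTheta Δ S θ) :
    ∃ t, θ = P.root t ∧ IsAffineVertex Δ S t := by
  have hρ {i : ι} (hi : i ∈ Δ.support) := hP.inner_rhoCheck_pos Δ S hi
  have hdom (t i : ι) (hi : i ∈ Δ.support) (h : P.root t - P.root (P.reflectionPerm i t) ∈
      AddSubmonoid.closure (P.root '' Δ.support)) : 0 ≤ (inner ℝ (P.root t) (P.root i) : ℝ) := by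
    have h1 := inner_nonneg_of_mem_closure (fun i hi ↦ (hρ hi).le) h
    rw [P.root_reflectionPerm, hP.reflection_apply, sub_sub_cancel, real_inner_smul_right] at h1
    exact (corootPairing_nonneg_iff _ _).1 (nonneg_of_mul_nonneg_left h1 (hρ hi))
  have hpos (t : ι) (h : P.root t - P.root (P.reflectionPerm t t) ∈
      AddSubmonoid.closure (P.root '' Δ.support)) : Δ.IsPos t := by
    have h1 := inner_nonneg_of_mem_closure (fun i hi ↦ (hρ hi).le) h
    by_contra hneg
    have h2 : P.root (P.reflectionPerm t t) = -P.root t := by simp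
    have h3 := inner_pos_of_isPos (fun i hi ↦ hρ hi) ((IsPos.not_of_root_eq_neg h2).2 hneg)
    rw [h2, inner_neg_right] at h3
    rw [h2, sub_neg_eq_add, inner_add_right] at h1
    linarith
  cases S
  · obtain ⟨t, rfl, hmax⟩ := hθ
    have htpos := hpos t (hmax _)
    refine ⟨t, rfl, rfl, htpos, fun i hi ↦ hdom t i hi (hmax _), fun j hj ↦ ?_, fun x hx hxt ↦ ?_⟩
    · obtain ⟨m, hm⟩ := hP.exists_int_pairing j t
      by_contra! hlt
      rw [hm] at hlt
      simp only [spacing] at hlt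
      have hm2 : 2 ≤ m := by
        have : 1 < m := by exact_mod_cast hlt
        omega
      -- If `m ≥ 2`, the root `-s_θ(β) = mθ - β` lies below `θ`, so `(ρ̌, β) ≥ (m - 1)(ρ̌, θ) ≥ (ρ̌,
      -- θ)`; as `β` lies below `θ` too, `β = θ`.
      obtain ⟨k, hk⟩ := exists_root_eq_neg P (P.reflectionPerm t j)
      rw [P.root_reflectionPerm, hP.reflection_apply, hm] at hk
      have h1 := inner_nonneg_of_mem_closure (fun i hi ↦ (hρ hi).le) (hmax k)
      have h2 := inner_nonneg_of_mem_closure (fun i hi ↦ (hρ hi).le) (hmax j)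
      have h3 := inner_pos_of_isPos (fun i hi ↦ hρ hi) htpos
      rw [hk, neg_sub, inner_sub_right, inner_sub_right, real_inner_smul_right] at h1
      rw [inner_sub_right] at h2
      have hm2' : (2 : ℝ) ≤ m := by exact_mod_cast hm2
      have h4 := eq_zero_of_mem_closure (fun i hi ↦ hρ hi) (hmax j)
        (by rw [inner_sub_right]; nlinarith)
      exact hj (P.root.injective (sub_eq_zero.1 h4).symm)
    -- For dominant `x`, every root pairs at most as `θ` does. Applying this to a root and its
    -- opposite makes `x` orthogonal to all roots.
    · have hle (j : ι) : (inner ℝ x (P.root j) : ℝ) ≤ 0 := by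
        have := inner_nonneg_of_mem_closure hx (hmax j)
        rw [inner_sub_right] at this
        linarith
      refine hP.eq_zero_of_forall_inner_eq_zero fun j ↦ le_antisymm (hle j) ?_
      obtain ⟨k, hk⟩ := exists_root_eq_neg P j
      have := hle k
      rw [hk, inner_neg_right] at this
      linarith
  · obtain ⟨t, rfl, hshort, hmax⟩ := hθ
    have hnorm (i j : ι) : ‖P.root (P.reflectionPerm j i)‖ = ‖P.root i‖ := by
      have := hP.inner_root_reflectionPerm i j
      rw [real_inner_self_eq_norm_sq, real_inner_self_eq_norm_sq] at this
      exact (pow_left_inj₀ (norm_nonneg _) (norm_nonneg _) two_ne_zero).1 this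
    have hmax' (i : ι) := hmax (P.reflectionPerm i t) (fun k ↦ by rw [hnorm]; exact hshort k)
    have ht2 := hP.short_eq_two t hshort
    refine ⟨t, rfl, by simp only [spacing, ht2]; norm_num, hpos t (hmax' t), fun i hi ↦ hdom t i hi (hmax' i),
      fun j hj ↦ ?_, fun x hx hxt ↦ ?_⟩
    · obtain ⟨m, hm⟩ := hP.exists_int_pairing t j
      have h1 := corootPairing_mul_inner_self (P.root t) j (P := P)
      have h2 := corootPairing_mul_inner_self (P.root j) t (P := P)
      have hjt : (2 : ℝ) ≤ inner ℝ (P.root j) (P.root j) := by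
        rw [← ht2, real_inner_self_eq_norm_sq, real_inner_self_eq_norm_sq]
        exact pow_le_pow_left₀ (norm_nonneg _) (hshort j) 2
      -- As `θ` is short and different from `β`, positivity of `|θ - β|²` gives `(θ, β) < (β, β)`,
      -- so the integer `(θ, β^∨)` is at most 1. Multiplying by `ν_β` yields the bound.
      have h3 : (0 : ℝ) < inner ℝ (P.root t - P.root j) (P.root t - P.root j) := by
        rw [real_inner_self_pos, sub_ne_zero]
        exact fun h ↦ hj (P.root.injective h).symm
      rw [real_inner_sub_sub_self, ht2] at h3
      have h4 : (m : ℝ) < 2 := by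
        rw [hm] at h1
        nlinarith
      have h5 : (m : ℝ) ≤ 1 := by
        have : m < 2 := by exact_mod_cast h4
        exact_mod_cast (by omega : m ≤ 1)
      rw [hm] at h1
      rw [ht2, real_inner_comm (P.root t) (P.root j)] at h2
      simp only [spacing]
      nlinarith
    · have hle (j : ι) (hj : ∀ k, ‖P.root j‖ ≤ ‖P.root k‖) : (inner ℝ x (P.root j) : ℝ) ≤ 0 := by
        have := inner_nonneg_of_mem_closure hx (hmax j hj)
        rw [inner_sub_right] at this
        linarith
      refine hP.eq_zero_of_forall_short fun j hj ↦ le_antisymm (hle j hj) ?_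
      have := hle (P.reflectionPerm j j) (fun k ↦ by rw [hnorm]; exact hj k)
      simp only [RootPairing.root_reflectionPerm, RootPairing.reflection_apply_self,
        inner_neg_right] at this
      linarith

end FiniteRootSystem

/-! ### The extended affine Weyl group: affine roots, inversions, length, reduced decompositions. -/

section AffineWeylGroup

variable {ι V N : Type*} [Fintype ι] [NormedAddCommGroup V] [InnerProductSpace ℝ V]
  [AddCommGroup N] [Module ℝ N] {P : RootPairing ι ℝ V N}

theorem affineReflection_apply (α z : V × ℝ) :
    affineReflection α z = z - corootPairing z.1 α.1 • α := rfl

theorem translation_apply (a : V) (z : V × ℝ) :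
    translation a z = (z.1, z.2 - inner ℝ z.1 a) := rfl

theorem ofWeyl_apply (w : P.weylGroup) (z : V × ℝ) : ofWeyl w z = (w • z.1, z.2) := rfl

theorem corootPairing_neg_left (x y : V) : corootPairing (-x) y = -corootPairing x y := by
  simp [corootPairing, neg_div]

theorem corootPairing_neg_right (x y : V) : corootPairing x (-y) = -corootPairing x y := by
  simp [corootPairing, neg_div]

theorem corootPairing_self {x : V} (hx : x ≠ 0) : corootPairing x x = 2 := by
  have : (inner ℝ x x : ℝ) ≠ 0 := fun h ↦ hx (inner_self_eq_zero.1 h)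
  rw [corootPairing]; field_simp

theorem affineReflection_neg (α : V × ℝ) : affineReflection (-α) = affineReflection α := by
  refine LinearMap.ext fun z ↦ ?_
  simp [affineReflection_apply, corootPairing_neg_right]

theorem affineReflection_self {α : V × ℝ} (hα : α.1 ≠ 0) : affineReflection α α = -α := by
  rw [affineReflection_apply, corootPairing_self hα, two_smul]; abel

theorem affineReflection_mul_self {α : V × ℝ} (hα : α.1 ≠ 0) :
    affineReflection α * affineReflection α = 1 := by
  refine LinearMap.ext fun z ↦ ?_
  rw [Module.End.mul_apply, Module.End.one_apply, affineReflection_apply α z, map_sub, map_smul,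
    affineReflection_self hα, affineReflection_apply]
  module

theorem affineReflection_affineReflection {α : V × ℝ} (hα : α.1 ≠ 0) (z : V × ℝ) :
    affineReflection α (affineReflection α z) = z := by
  rw [← Module.End.mul_apply, affineReflection_mul_self hα, Module.End.one_apply]

/-- The affine roots. -/
def affineRoots (P : RootPairing ι ℝ V N) (S : Setting) : Set (V × ℝ) :=
  {z | ∃ (i : ι) (j : ℤ), z = (P.root i, spacing P S i * j)}

variable {S : Setting} {Δ : P.Base}

theorem positiveAffineRoots_subset : positiveAffineRoots Δ S ⊆ affineRoots P S := by
  rintro z ⟨i, j, rfl, -⟩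
  exact ⟨i, j, rfl⟩

theorem fst_ne_zero_of_mem_affineRoots {z : V × ℝ} (hz : z ∈ affineRoots P S) : z.1 ≠ 0 := by
  obtain ⟨i, j, rfl⟩ := hz
  exact P.ne_zero i

variable [P.IsCrystallographic]

theorem mem_or_neg_mem_positiveAffineRoots {z : V × ℝ} (hz : z ∈ affineRoots P S) :
    z ∈ positiveAffineRoots Δ S ∨ -z ∈ positiveAffineRoots Δ S := by
  obtain ⟨i, j, rfl⟩ := hz
  obtain ⟨k, hk⟩ := exists_root_eq_neg P i
  have hneg : (-(P.root i, spacing P S i * j) : V × ℝ) = (P.root k, spacing P S k * (-j : ℤ)) := by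
    rw [spacing_congr (i := k) (j := i) (by rw [hk, inner_neg_neg]), hk]
    simp
  rcases lt_trichotomy j 0 with hj | rfl | hj
  · exact Or.inr ⟨k, -j, hneg, Or.inl (by omega)⟩
  · by_cases hi : Δ.IsPos i
    · exact Or.inl ⟨i, 0, rfl, Or.inr ⟨rfl, hi⟩⟩
    · exact Or.inr ⟨k, -0, hneg, Or.inr ⟨rfl, (IsPos.not_of_root_eq_neg hk).2 hi⟩⟩
  · exact Or.inl ⟨i, j, rfl, Or.inl hj⟩

theorem snd_nonneg_of_mem_positiveAffineRoots {z : V × ℝ} (hz : z ∈ positiveAffineRoots Δ S) :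
    0 ≤ z.2 := by
  obtain ⟨i, j, rfl, hj⟩ := hz
  have : 0 ≤ j := by rcases hj with h | h <;> omega
  exact mul_nonneg (spacing_pos P S i).le (by exact_mod_cast this)

/-- A root of `P` gives a positive affine root `[α, 0]` only if `(ρ̌, α) > 0`. -/
theorem inner_rhoCheck_pos_of_snd_eq_zero [P.IsReduced] (hP : IsNormalizedForm P) {z : V × ℝ}
    (hz : z ∈ positiveAffineRoots Δ S) (h : z.2 = 0) :
    0 < (inner ℝ (rhoCheck Δ S) z.1 : ℝ) := by
  obtain ⟨i, j, rfl, hj⟩ := hz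
  have : j = 0 := by
    simpa [(spacing_pos P S i).ne'] using h
  refine inner_pos_of_isPos (fun i hi ↦ hP.inner_rhoCheck_pos Δ S hi) ?_
  rcases hj with h | h
  · omega
  · exact h.2

/-- The positive affine roots lie in a salient convex cone. -/
theorem add_smul_add_ne_zero [P.IsReduced] (hP : IsNormalizedForm P) {x y z : V × ℝ}
    (hx : x ∈ positiveAffineRoots Δ S) (hy : y ∈ positiveAffineRoots Δ S)
    (hz : z ∈ positiveAffineRoots Δ S) {c : ℝ} (hc : 0 < c) : x + y + c • z ≠ 0 := by
  intro h
  have h2 := congrArg Prod.snd h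
  have h1 := congrArg (fun v : V × ℝ ↦ (inner ℝ (rhoCheck Δ S) v.1 : ℝ)) h
  simp only [Prod.snd_add, Prod.smul_snd, Prod.snd_zero, smul_eq_mul] at h2
  simp only [Prod.fst_add, Prod.smul_fst, Prod.fst_zero, inner_add_right, inner_smul_right,
    inner_zero_right] at h1
  have hx0 := snd_nonneg_of_mem_positiveAffineRoots hx
  have hy0 := snd_nonneg_of_mem_positiveAffineRoots hy
  have hz0 := snd_nonneg_of_mem_positiveAffineRoots hz
  have hcz := mul_nonneg hc.le hz0
  have hx1 := inner_rhoCheck_pos_of_snd_eq_zero hP hx (by linarith)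
  have hy1 := inner_rhoCheck_pos_of_snd_eq_zero hP hy (by linarith)
  have hz1 := inner_rhoCheck_pos_of_snd_eq_zero hP hz (by nlinarith)
  nlinarith [mul_pos hc hz1]

theorem neg_notMem_positiveAffineRoots [P.IsReduced] (hP : IsNormalizedForm P) {z : V × ℝ}
    (hz : z ∈ positiveAffineRoots Δ S) : -z ∉ positiveAffineRoots Δ S := by
  intro h
  have h0 := snd_nonneg_of_mem_positiveAffineRoots hz
  have h1 := snd_nonneg_of_mem_positiveAffineRoots h
  simp only [Prod.snd_neg] at h1
  have h2 := inner_rhoCheck_pos_of_snd_eq_zero hP hz (by linarith)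
  have h3 := inner_rhoCheck_pos_of_snd_eq_zero hP h (by simp only [Prod.snd_neg]; linarith)
  simp only [Prod.fst_neg, inner_neg_right] at h3
  linarith

theorem exists_apply_eq {g : Module.End ℝ (V × ℝ)} (hg : g ∈ extendedAffineWeyl P S) :
    ∃ w : P.weylGroup, ∃ a ∈ translationLattice P S,
      ∀ z, g z = (w • z.1, z.2 - inner ℝ z.1 a) := by
  obtain ⟨w, a, ha, rfl⟩ := hg
  exact ⟨w, a, ha, fun z ↦ rfl⟩

theorem mem_extendedAffineWeyl_of_apply {g : Module.End ℝ (V × ℝ)} (w : P.weylGroup) {a : V}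
    (ha : a ∈ translationLattice P S) (h : ∀ z, g z = (w • z.1, z.2 - inner ℝ z.1 a)) :
    g ∈ extendedAffineWeyl P S :=
  ⟨w, a, ha, LinearMap.ext h⟩

namespace IsNormalizedForm

variable (hP : IsNormalizedForm P)
include hP

theorem mul_mem_extendedAffineWeyl {g h : Module.End ℝ (V × ℝ)}
    (hg : g ∈ extendedAffineWeyl P S) (hh : h ∈ extendedAffineWeyl P S) :
    g * h ∈ extendedAffineWeyl P S := by
  obtain ⟨w, a, ha, hw⟩ := exists_apply_eq hg
  obtain ⟨u, b, hb, hu⟩ := exists_apply_eq hh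
  refine mem_extendedAffineWeyl_of_apply (w * u)
    (add_mem (hP.smul_mem_translationLattice u⁻¹ ha) hb) fun z ↦ ?_
  rw [Module.End.mul_apply, hu, hw]
  simp only [mul_smul, inner_add_right, Prod.mk.injEq, true_and]
  rw [← hP.inner_smul_smul u z.1 (u⁻¹ • a), smul_inv_smul]
  ring

theorem one_mem_extendedAffineWeyl : (1 : Module.End ℝ (V × ℝ)) ∈ extendedAffineWeyl P S :=
  mem_extendedAffineWeyl_of_apply 1 (zero_mem _) fun z ↦ by simp

theorem exists_inverse {g : Module.End ℝ (V × ℝ)} (hg : g ∈ extendedAffineWeyl P S) :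
    ∃ h ∈ extendedAffineWeyl P S, g * h = 1 ∧ h * g = 1 := by
  obtain ⟨w, a, ha, hw⟩ := exists_apply_eq hg
  have hmem : ofWeyl w⁻¹ * translation (-(w • a)) ∈ extendedAffineWeyl P S :=
    ⟨w⁻¹, -(w • a), neg_mem (hP.smul_mem_translationLattice w ha), rfl⟩
  refine ⟨_, hmem, LinearMap.ext fun z ↦ ?_, LinearMap.ext fun z ↦ ?_⟩
  · rw [Module.End.mul_apply, hw, Module.End.mul_apply, translation_apply, ofWeyl_apply]
    ext
    · simp
    · have := hP.inner_smul_smul w (w⁻¹ • z.1) a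
      rw [smul_inv_smul] at this
      simp [this]
  · rw [Module.End.mul_apply, hw, Module.End.mul_apply, translation_apply, ofWeyl_apply]
    ext
    · simp
    · simp [hP.inner_smul_smul]

theorem affineReflection_mem {z : V × ℝ} (hz : z ∈ affineRoots P S) :
    affineReflection z ∈ extendedAffineWeyl P S := by
  obtain ⟨i, j, rfl⟩ := hz
  refine mem_extendedAffineWeyl_of_apply (RootPairing.weylGroup.ofIdx P i)
    (hP.smul_root_mem_translationLattice S i j) fun z ↦ ?_
  rw [ofIdx_smul_eq, hP.reflection_apply, affineReflection_apply]
  ext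
  · simp
  · simp only [Prod.snd_sub, Prod.smul_snd, smul_eq_mul, real_inner_smul_right, corootPairing]
    ring

theorem map_mem_affineRoots {g : Module.End ℝ (V × ℝ)} (hg : g ∈ extendedAffineWeyl P S)
    {z : V × ℝ} (hz : z ∈ affineRoots P S) : g z ∈ affineRoots P S := by
  obtain ⟨w, a, ha, hw⟩ := exists_apply_eq hg
  obtain ⟨i, j, rfl⟩ := hz
  obtain ⟨k, hk⟩ := exists_root_eq_weyl_smul w i
  obtain ⟨n, hn⟩ := hP.exists_int_inner_translation ha i
  refine ⟨k, j - n, ?_⟩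
  rw [hw, hk, spacing_congr (hP.inner_root_eq_of_smul_eq hk)]
  simp only [Prod.mk.injEq, true_and]
  rw [hn]; push_cast; ring

theorem inner_map_map {g : Module.End ℝ (V × ℝ)} (hg : g ∈ extendedAffineWeyl P S)
    (y z : V × ℝ) : (inner ℝ (g y).1 (g z).1 : ℝ) = inner ℝ y.1 z.1 := by
  obtain ⟨w, a, ha, hw⟩ := exists_apply_eq hg
  rw [hw, hw, hP.inner_smul_smul]

theorem mul_affineReflection {g : Module.End ℝ (V × ℝ)} (hg : g ∈ extendedAffineWeyl P S)
    (z : V × ℝ) : g * affineReflection z = affineReflection (g z) * g := by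
  refine LinearMap.ext fun y ↦ ?_
  rw [Module.End.mul_apply, Module.End.mul_apply, affineReflection_apply, affineReflection_apply,
    map_sub, map_smul, corootPairing, corootPairing, hP.inner_map_map hg, hP.inner_map_map hg]

/-- An element of the extended affine Weyl group is a bijection of the affine roots. -/
theorem exists_map_eq {g : Module.End ℝ (V × ℝ)} (hg : g ∈ extendedAffineWeyl P S)
    {z : V × ℝ} (hz : z ∈ affineRoots P S) : ∃ y ∈ affineRoots P S, g y = z := by
  obtain ⟨h, hh, h1, -⟩ := hP.exists_inverse hg
  exact ⟨h z, hP.map_mem_affineRoots hh hz, by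
    rw [← Module.End.mul_apply, h1, Module.End.one_apply]⟩

theorem injective_of_mem {g : Module.End ℝ (V × ℝ)} (hg : g ∈ extendedAffineWeyl P S) :
    Function.Injective g := by
  obtain ⟨h, -, -, h1⟩ := hP.exists_inverse hg
  intro x y hxy
  have := congrArg h hxy
  rwa [← Module.End.mul_apply, ← Module.End.mul_apply, h1] at this

theorem ofWeyl_mem (w : P.weylGroup) : ofWeyl w ∈ extendedAffineWeyl P S :=
  mem_extendedAffineWeyl_of_apply w (zero_mem _) fun z ↦ by simp [ofWeyl_apply]

theorem translation_mem {a : V} (ha : a ∈ translationLattice P S) :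
    translation a ∈ extendedAffineWeyl P S :=
  mem_extendedAffineWeyl_of_apply 1 ha fun z ↦ by simp [translation_apply]

theorem piRho_mem [P.IsReduced] (w : P.weylGroup) : piRho Δ S w ∈ extendedAffineWeyl P S :=
  hP.mul_mem_extendedAffineWeyl (hP.translation_mem (hP.rhoCheck_mem_translationLattice Δ S))
    (hP.ofWeyl_mem w)

/-- Over each finite root, an inversion has its imaginary part between 0 and the shift caused by the
translation part. Finiteness is essential because `length` is an `ncard`, which is 0 on infinite
sets. -/
theorem finite_inversions {g : Module.End ℝ (V × ℝ)} (hg : g ∈ extendedAffineWeyl P S) :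
    {z | z ∈ positiveAffineRoots Δ S ∧ -(g z) ∈ positiveAffineRoots Δ S}.Finite := by
  obtain ⟨w, a, ha, hw⟩ := exists_apply_eq hg
  refine (Set.finite_iUnion fun i : ι ↦ (Set.finite_Icc (0 : ℤ)
    ⌈(inner ℝ (P.root i) a : ℝ) / spacing P S i⌉).image
      fun j : ℤ ↦ (P.root i, spacing P S i * j)).subset ?_
  rintro z ⟨⟨i, j, rfl, hj⟩, hneg⟩
  have h := snd_nonneg_of_mem_positiveAffineRoots hneg
  rw [hw] at h
  simp only [Prod.snd_neg] at h
  refine Set.mem_iUnion.2 ⟨i, j, ⟨?_, ?_⟩, rfl⟩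
  · rcases hj with h | h <;> omega
  · have h1 : (j : ℝ) ≤ inner ℝ (P.root i) a / spacing P S i := by
      rw [le_div_iff₀ (spacing_pos P S i)]; linarith
    exact_mod_cast h1.trans (Int.le_ceil _)

end IsNormalizedForm

variable [P.IsReduced] {t : ι}

theorem simpleAffineRoot_mem (ht : IsAffineVertex Δ S t) (i : Option Δ.support) :
    simpleAffineRoot Δ (P.root t) i ∈ positiveAffineRoots Δ S := by
  cases i with
  | none =>
    obtain ⟨k, hk⟩ := exists_root_eq_neg P t
    refine ⟨k, 1, ?_, Or.inl one_pos⟩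
    rw [spacing_congr (i := k) (j := t) (by rw [hk, inner_neg_neg]), ht.spacing_eq, hk]
    simp [simpleAffineRoot]
  | some i =>
    exact ⟨i, 0, by simp [simpleAffineRoot],
      Or.inr ⟨rfl, RootPairing.Base.isPos_of_mem_support i.2⟩⟩

/-- A simple affine reflection permutes the other positive affine roots. -/
theorem affineReflection_simple_mem (hP : IsNormalizedForm P) (ht : IsAffineVertex Δ S t)
    (i : Option Δ.support) {z : V × ℝ} (hz : z ∈ positiveAffineRoots Δ S)
    (hne : z ≠ simpleAffineRoot Δ (P.root t) i) :
    affineReflection (simpleAffineRoot Δ (P.root t) i) z ∈ positiveAffineRoots Δ S := by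
  obtain ⟨k, j, rfl, hj⟩ := hz
  cases i with
  | some i =>
    have heq : affineReflection (simpleAffineRoot Δ (P.root t) (some i))
        (P.root k, spacing P S k * j) =
        (P.root (P.reflectionPerm i k), spacing P S (P.reflectionPerm i k) * j) := by
      rw [spacing_congr (hP.inner_root_reflectionPerm k i), P.root_reflectionPerm,
        hP.reflection_apply, affineReflection_apply]
      simp [simpleAffineRoot]
    rw [heq]
    refine ⟨_, j, rfl, hj.imp_right fun h ↦ ⟨h.1, h.2.reflectionPerm i.2 ?_⟩⟩
    rintro rfl
    exact hne (by simp [simpleAffineRoot, h.1])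
  | none =>
    obtain ⟨n, hn⟩ := hP.exists_int_pairing_mul_spacing S k t
    rw [ht.spacing_eq, mul_one] at hn
    have hs := spacing_pos P S k
    have heq : affineReflection (simpleAffineRoot Δ (P.root t) none)
        (P.root k, spacing P S k * j) =
        (P.root (P.reflectionPerm t k), spacing P S (P.reflectionPerm t k) * (j + n : ℤ)) := by
      rw [spacing_congr (hP.inner_root_reflectionPerm k t), P.root_reflectionPerm,
        hP.reflection_apply, affineReflection_apply]
      ext
      · simp [simpleAffineRoot, corootPairing_neg_right]
      · simp only [simpleAffineRoot, corootPairing_neg_right, hn]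
        simp; ring
    rw [heq]
    refine ⟨_, j + n, rfl, ?_⟩
    have hdom (l : ι) (hl : Δ.IsPos l) : 0 ≤ corootPairing (P.root l) (P.root t) := by
      rw [corootPairing_nonneg_iff, real_inner_comm]
      exact inner_nonneg_of_isPos ht.dominant hl
    -- The reflection `s_0` turns the level `j` into `j + n`. Only `n < 0` is delicate: the level
    -- must stay nonnegative, and at level 0 the finite root must be positive.
    rcases lt_trichotomy n 0 with hn0 | rfl | hn0
    · have hn0' : (n : ℝ) < 0 := by exact_mod_cast hn0
      have hneg : corootPairing (P.root k) (P.root t) < 0 := by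
        rw [hn]; exact mul_neg_of_pos_of_neg hs hn0'
      have hj1 : 0 < j := by
        rcases hj with h | h
        · exact h
        · exact absurd (hdom k h.2) hneg.not_ge
      have hpos : Δ.IsPos (P.reflectionPerm t k) := by
        by_contra hcon
        obtain ⟨l, hl⟩ := exists_root_eq_neg P (P.reflectionPerm t k)
        have h1 := hdom l ((IsPos.not_of_root_eq_neg hl).2 hcon)
        rw [hl, P.root_reflectionPerm, corootPairing_neg_left, ← ofIdx_smul_eq,
          ← hP.corootPairing_smul_smul (RootPairing.weylGroup.ofIdx P t), ofIdx_smul_eq,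
          ofIdx_smul_eq, P.reflection_same, ofIdx_smul_eq, P.reflection_apply_self,
          corootPairing_neg_right] at h1
        linarith
      -- Away from `-θ` one has `n ≥ -1`, and `j ≥ 1` suffices. For `-θ` itself `n = -2`, but there
      -- `j = 1` is the excluded root `α_0`.
      have hge : 0 ≤ j + n := by
        obtain ⟨l, hl⟩ := exists_root_eq_neg P k
        by_cases hlt : l = t
        · have hk : P.root k = -P.root t := by rw [← hlt, hl, neg_neg]
          have hsk : spacing P S k = 1 := by
            rw [← ht.spacing_eq]; exact spacing_congr (by rw [hk, inner_neg_neg])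
          rw [hk, corootPairing_neg_left, corootPairing_self (P.ne_zero t), hsk, one_mul] at hn
          have hn2 : n = -2 := by exact_mod_cast hn.symm
          have : j ≠ 1 := by
            rintro rfl
            exact hne (by simp [simpleAffineRoot, hk, hsk])
          omega
        · have h1 := ht.pairing_le l hlt
          rw [hl, corootPairing_neg_left, hn,
            spacing_congr (i := l) (j := k) (by rw [hl, inner_neg_neg])] at h1
          have h2 : (-1 : ℝ) ≤ n := by nlinarith
          have h3 : -1 ≤ n := by exact_mod_cast h2
          omega
      rcases hge.lt_or_eq with h | h
      · exact Or.inl h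
      · exact Or.inr ⟨h.symm, hpos⟩
    · have hk : P.reflectionPerm t k = k := by
        apply P.root.injective
        rw [P.root_reflectionPerm, hP.reflection_apply, hn]; simp
      rw [hk, add_zero]; exact hj
    · left
      rcases hj with h | h <;> omega

/-- If an element of the extended affine Weyl group has an inversion, then it has a simple one. -/
theorem exists_simple_inversion [P.IsRootSystem] (hP : IsNormalizedForm P)
    (ht : IsAffineVertex Δ S t)
    {g : Module.End ℝ (V × ℝ)} (hg : g ∈ extendedAffineWeyl P S)
    (h : {z | z ∈ positiveAffineRoots Δ S ∧ -(g z) ∈ positiveAffineRoots Δ S}.Nonempty) :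
    ∃ i, -(g (simpleAffineRoot Δ (P.root t) i)) ∈ positiveAffineRoots Δ S := by
  by_contra! hcon
  have hsimple (i : Option Δ.support) :
      g (simpleAffineRoot Δ (P.root t) i) ∈ positiveAffineRoots Δ S :=
    (mem_or_neg_mem_positiveAffineRoots (hP.map_mem_affineRoots hg
      (positiveAffineRoots_subset (simpleAffineRoot_mem ht i)))).resolve_right (hcon i)
  have hρθ : 0 < (inner ℝ (rhoCheck Δ S) (P.root t) : ℝ) :=
    inner_pos_of_isPos (fun i hi ↦ hP.inner_rhoCheck_pos Δ S hi) ht.isPos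
  -- A linear functional positive on all simple affine roots; the coefficient of the imaginary part
  -- is chosen so that `f(α_0) = 1`.
  set f : V × ℝ → ℝ := fun z ↦
    inner ℝ (rhoCheck Δ S) z.1 + (1 + inner ℝ (rhoCheck Δ S) (P.root t)) * z.2 with hf
  have hfpos (i : Option Δ.support) : 0 < f (simpleAffineRoot Δ (P.root t) i) := by
    cases i with
    | none => simp [hf, simpleAffineRoot]
    | some i => simpa [hf, simpleAffineRoot] using hP.inner_rhoCheck_pos Δ S i.2
  -- If an inversion `γ` minimizing `f` paired positively with some `α_i`, then `s_i γ` would be an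
  -- inversion with smaller `f`. So `γ` pairs nonpositively with all simple affine roots, which
  -- forces its finite part to vanish.
  obtain ⟨γ, ⟨hγ, hγneg⟩, hmin⟩ := Set.exists_min_image _ f (hP.finite_inversions (Δ := Δ) hg) h
  have hle (i : Option Δ.support) :
      (inner ℝ γ.1 (simpleAffineRoot Δ (P.root t) i).1 : ℝ) ≤ 0 := by
    by_contra! hlt
    set α := simpleAffineRoot Δ (P.root t) i with hα
    have hαpos : α ∈ positiveAffineRoots Δ S := simpleAffineRoot_mem ht i
    have hne : γ ≠ α := by
      rintro rfl
      exact neg_notMem_positiveAffineRoots hP (hsimple i) hγneg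
    have hmem := affineReflection_simple_mem hP ht i hγ hne
    rw [← hα] at hmem
    have hc : 0 < corootPairing γ.1 α.1 := by
      have : 0 < (inner ℝ α.1 α.1 : ℝ) := real_inner_self_pos.2
        (fst_ne_zero_of_mem_affineRoots (positiveAffineRoots_subset hαpos))
      rw [corootPairing]; positivity
    have hneg : -(g (affineReflection α γ)) ∈ positiveAffineRoots Δ S := by
      refine (mem_or_neg_mem_positiveAffineRoots (hP.map_mem_affineRoots hg
        (positiveAffineRoots_subset hmem))).resolve_left fun hpos ↦ ?_
      -- Were `g(s_i γ)` positive, then `g(s_i γ) + (-gγ) + c·gα_i = 0` would be a vanishing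
      -- positive combination of positive roots.
      refine add_smul_add_ne_zero hP hpos hγneg (hsimple i) hc ?_
      rw [affineReflection_apply, map_sub, map_smul]
      abel
    have h1 := hmin _ ⟨hmem, hneg⟩
    have h2 : f (affineReflection α γ) = f γ - corootPairing γ.1 α.1 * f α := by
      simp only [hf, affineReflection_apply, Prod.fst_sub, Prod.snd_sub, Prod.smul_fst,
        Prod.smul_snd, inner_sub_right, real_inner_smul_right, smul_eq_mul]
      ring
    have h3 := mul_pos hc (hfpos i)
    rw [← hα] at h3
    linarith
  have h0 := ht.eq_zero (-γ.1) (fun i hi ↦ by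
      have := hle (some ⟨i, hi⟩)
      simp only [simpleAffineRoot] at this
      rw [inner_neg_left]; linarith) (by
      have := hle none
      simp only [simpleAffineRoot, inner_neg_right] at this
      rw [inner_neg_left]; linarith)
  exact fst_ne_zero_of_mem_affineRoots (positiveAffineRoots_subset hγ) (neg_eq_zero.1 h0)

/-- The product of the simple affine reflections of a word. -/
def wordProd (Δ : P.Base) (θ : V) (word : List (Option Δ.support)) : Module.End ℝ (V × ℝ) :=
  (word.map fun i ↦ affineReflection (simpleAffineRoot Δ θ i)).prod

@[simp] theorem wordProd_nil (θ : V) : wordProd Δ θ [] = 1 := rfl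

@[simp] theorem wordProd_cons (θ : V) (i : Option Δ.support) (word : List (Option Δ.support)) :
    wordProd Δ θ (i :: word) = affineReflection (simpleAffineRoot Δ θ i) * wordProd Δ θ word := by
  simp [wordProd]

section Length

variable (hP : IsNormalizedForm P) (ht : IsAffineVertex Δ S t)
include hP ht

theorem affineReflection_simpleAffineRoot_mem (i : Option Δ.support) :
    affineReflection (simpleAffineRoot Δ (P.root t) i) ∈ extendedAffineWeyl P S :=
  hP.affineReflection_mem (positiveAffineRoots_subset (simpleAffineRoot_mem ht i))

theorem wordProd_mem (word : List (Option Δ.support)) :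
    wordProd Δ (P.root t) word ∈ extendedAffineWeyl P S := by
  induction word with
  | nil => exact hP.one_mem_extendedAffineWeyl
  | cons i word ih =>
    rw [wordProd_cons]
    exact hP.mul_mem_extendedAffineWeyl (affineReflection_simpleAffineRoot_mem hP ht i) ih

theorem simpleAffineRoot_fst_ne_zero (i : Option Δ.support) :
    (simpleAffineRoot Δ (P.root t) i).1 ≠ 0 :=
  fst_ne_zero_of_mem_affineRoots (positiveAffineRoots_subset (simpleAffineRoot_mem ht i))

/-- Since `s_i` permutes the positive roots other than `α_i`, the inversions of `g` are `α_i`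
together with the `s_i`-images of those of `g s_i`. -/
theorem length_mul_simple {g : Module.End ℝ (V × ℝ)} (hg : g ∈ extendedAffineWeyl P S)
    {i : Option Δ.support}
    (hi : -(g (simpleAffineRoot Δ (P.root t) i)) ∈ positiveAffineRoots Δ S) :
    length Δ S (g * affineReflection (simpleAffineRoot Δ (P.root t) i)) + 1 = length Δ S g := by
  set α := simpleAffineRoot Δ (P.root t) i with hα
  have hαpos : α ∈ positiveAffineRoots Δ S := simpleAffineRoot_mem ht i
  have hα0 : α.1 ≠ 0 := simpleAffineRoot_fst_ne_zero hP ht i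
  have hinj : Function.Injective (affineReflection α) :=
    hP.injective_of_mem (affineReflection_simpleAffineRoot_mem hP ht i)
  have hset : {z | z ∈ positiveAffineRoots Δ S ∧ -(g z) ∈ positiveAffineRoots Δ S} =
      insert α (affineReflection α '' {z | z ∈ positiveAffineRoots Δ S ∧
        -((g * affineReflection α) z) ∈ positiveAffineRoots Δ S}) := by
    ext z
    simp only [Set.mem_insert_iff, Set.mem_image, Set.mem_ofPred_eq]
    constructor
    · rintro ⟨hz, hgz⟩
      by_cases hne : z = α
      · exact Or.inl hne
      · refine Or.inr ⟨affineReflection α z, ⟨affineReflection_simple_mem hP ht i hz hne, ?_⟩, ?_⟩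
        · rwa [Module.End.mul_apply, affineReflection_affineReflection hα0]
        · exact affineReflection_affineReflection hα0 z
    · rintro (rfl | ⟨y, ⟨hy, hgy⟩, rfl⟩)
      · exact ⟨hαpos, hi⟩
      · refine ⟨affineReflection_simple_mem hP ht i hy ?_, hgy⟩
        rintro rfl
        rw [Module.End.mul_apply, affineReflection_self hα0, map_neg, neg_neg] at hgy
        exact neg_notMem_positiveAffineRoots hP hgy hi
  have hnot : α ∉ affineReflection α '' {z | z ∈ positiveAffineRoots Δ S ∧
        -((g * affineReflection α) z) ∈ positiveAffineRoots Δ S} := by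
    rintro ⟨y, ⟨hy, -⟩, hyα⟩
    have : y = -α := by
      rw [← affineReflection_affineReflection hα0 y, hyα, affineReflection_self hα0]
    rw [this] at hy
    exact neg_notMem_positiveAffineRoots hP hαpos hy
  have hfin := (hP.finite_inversions (Δ := Δ) (hP.mul_mem_extendedAffineWeyl hg
    (affineReflection_simpleAffineRoot_mem hP ht i))).image (affineReflection α)
  rw [length, length, hset, Set.ncard_insert_of_notMem hnot hfin, Set.ncard_image_of_injective _ hinj]

/-- The only possible new inversion of `s_i g` is `g⁻¹(α_i)`, and it counts only if positive. The
second conjunct extracts this positivity from an increase in length. -/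
theorem length_simple_mul_le {g : Module.End ℝ (V × ℝ)} (hg : g ∈ extendedAffineWeyl P S)
    (i : Option Δ.support) :
    length Δ S (affineReflection (simpleAffineRoot Δ (P.root t) i) * g) ≤ length Δ S g + 1 ∧
    ((∃ δ ∈ positiveAffineRoots Δ S, g δ = simpleAffineRoot Δ (P.root t) i) ∨
      length Δ S (affineReflection (simpleAffineRoot Δ (P.root t) i) * g) ≤ length Δ S g) := by
  set α := simpleAffineRoot Δ (P.root t) i with hα
  have hαpos : α ∈ positiveAffineRoots Δ S := simpleAffineRoot_mem ht i
  have hα0 : α.1 ≠ 0 := simpleAffineRoot_fst_ne_zero hP ht i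
  obtain ⟨δ, hδ, hgδ⟩ := hP.exists_map_eq hg (positiveAffineRoots_subset hαpos)
  have hfin := hP.finite_inversions (Δ := Δ) hg
  have hsub : {z | z ∈ positiveAffineRoots Δ S ∧
        -((affineReflection α * g) z) ∈ positiveAffineRoots Δ S} ⊆
      {z | z = δ ∧ δ ∈ positiveAffineRoots Δ S} ∪
        {z | z ∈ positiveAffineRoots Δ S ∧ -(g z) ∈ positiveAffineRoots Δ S} := by
    rintro z ⟨hz, hgz⟩
    rw [Module.End.mul_apply] at hgz
    by_cases hzδ : z = δ
    · exact Or.inl ⟨hzδ, hzδ ▸ hz⟩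
    · refine Or.inr ⟨hz, (mem_or_neg_mem_positiveAffineRoots (hP.map_mem_affineRoots hg
        (positiveAffineRoots_subset hz))).resolve_left fun hpos ↦ ?_⟩
      refine neg_notMem_positiveAffineRoots hP
        (affineReflection_simple_mem hP ht i hpos fun h ↦ hzδ ?_) hgz
      exact hP.injective_of_mem hg (h.trans hgδ.symm)
  by_cases hδpos : δ ∈ positiveAffineRoots Δ S
  · refine ⟨?_, Or.inl ⟨δ, hδpos, hgδ⟩⟩
    rw [length, length, add_comm]
    refine (Set.ncard_le_ncard hsub ?_).trans ((Set.ncard_union_le _ _).trans ?_)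
    · exact ((Set.finite_singleton δ).subset fun z hz ↦ hz.1).union hfin
    · gcongr
      exact (Set.ncard_le_ncard (t := {δ}) fun z hz ↦ hz.1).trans (Set.ncard_singleton δ).le
  · have h : length Δ S (affineReflection α * g) ≤ length Δ S g := by
      rw [length, length]
      refine Set.ncard_le_ncard (fun z hz ↦ (hsub hz).resolve_left fun h ↦ hδpos h.2) hfin
    exact ⟨by omega, Or.inr h⟩

theorem length_wordProd_le [P.IsRootSystem] (word : List (Option Δ.support)) :
    length Δ S (wordProd Δ (P.root t) word) ≤ word.length := by
  induction word with
  | nil =>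
    rw [length, wordProd_nil, List.length_nil, Nat.le_zero, Set.ncard_eq_zero
      (hP.finite_inversions hP.one_mem_extendedAffineWeyl), Set.eq_empty_iff_forall_notMem]
    rintro z ⟨hz, hz'⟩
    exact neg_notMem_positiveAffineRoots hP hz hz'
  | cons i word ih =>
    have := (length_simple_mul_le hP ht (wordProd_mem hP ht word) i).1
    rw [wordProd_cons, List.length_cons]
    omega

/-- Every letter of a reduced word must raise the length by one. The resulting positive root `δ` is
the ascent condition required by the lifting lemmas. -/
theorem exists_of_length_wordProd_cons [P.IsRootSystem] {i : Option Δ.support}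
    {word : List (Option Δ.support)}
    (h : (i :: word).length = length Δ S (wordProd Δ (P.root t) (i :: word))) :
    word.length = length Δ S (wordProd Δ (P.root t) word) ∧
      ∃ δ ∈ positiveAffineRoots Δ S,
        wordProd Δ (P.root t) word δ = simpleAffineRoot Δ (P.root t) i := by
  have h1 := length_simple_mul_le hP ht (wordProd_mem hP ht word) i
  have h2 := length_wordProd_le hP ht word
  rw [wordProd_cons, List.length_cons] at h
  exact ⟨by omega, h1.2.resolve_right fun h3 ↦ by omega⟩

/-- An inversion of `π` would yield a simple one, whereas `π` sends simple affine roots to simple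
affine roots. -/
theorem map_pos_of_mem_piGroup [P.IsRootSystem] {π : Module.End ℝ (V × ℝ)}
    (hπ : π ∈ PiGroup Δ S (P.root t)) {z : V × ℝ} (hz : z ∈ positiveAffineRoots Δ S) :
    π z ∈ positiveAffineRoots Δ S := by
  by_contra hcon
  have hneg := (mem_or_neg_mem_positiveAffineRoots (hP.map_mem_affineRoots hπ.1
    (positiveAffineRoots_subset hz))).resolve_left hcon
  obtain ⟨i, hi⟩ := exists_simple_inversion hP ht hπ.1 ⟨z, hz, hneg⟩
  obtain ⟨j, hj⟩ : π (simpleAffineRoot Δ (P.root t) i) ∈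
      Set.range (simpleAffineRoot Δ (P.root t)) := by
    rw [← hπ.2]; exact Set.mem_image_of_mem _ ⟨i, rfl⟩
  rw [← hj] at hi
  exact neg_notMem_positiveAffineRoots hP (simpleAffineRoot_mem ht j) hi

theorem length_piGroup_mul [P.IsRootSystem] {π g : Module.End ℝ (V × ℝ)}
    (hπ : π ∈ PiGroup Δ S (P.root t)) (hg : g ∈ extendedAffineWeyl P S) :
    length Δ S (π * g) = length Δ S g := by
  rw [length, length]
  congr 1
  ext z
  refine and_congr_right fun hz ↦ ?_
  rw [Module.End.mul_apply]
  have hA := hP.map_mem_affineRoots hg (positiveAffineRoots_subset hz)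
  constructor
  · intro h
    refine (mem_or_neg_mem_positiveAffineRoots hA).resolve_left fun h' ↦ ?_
    exact neg_notMem_positiveAffineRoots hP (map_pos_of_mem_piGroup hP ht hπ h') h
  · intro h
    rw [← map_neg]
    exact map_pos_of_mem_piGroup hP ht hπ h

/-- An element without inversions permutes the simple affine roots. -/
theorem mem_piGroup_of_length_eq_zero [P.IsRootSystem] {g : Module.End ℝ (V × ℝ)}
    (hg : g ∈ extendedAffineWeyl P S) (h : length Δ S g = 0) : g ∈ PiGroup Δ S (P.root t) := by
  rw [length, Set.ncard_eq_zero (hP.finite_inversions hg), Set.eq_empty_iff_forall_notMem] at h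
  have hpos {z : V × ℝ} (hz : z ∈ positiveAffineRoots Δ S) : g z ∈ positiveAffineRoots Δ S :=
    (mem_or_neg_mem_positiveAffineRoots (hP.map_mem_affineRoots hg
      (positiveAffineRoots_subset hz))).resolve_right fun h' ↦ h z ⟨hz, h'⟩
  have hpos' {z : V × ℝ} (hz : g z ∈ positiveAffineRoots Δ S) (hA : z ∈ affineRoots P S) :
      z ∈ positiveAffineRoots Δ S :=
    (mem_or_neg_mem_positiveAffineRoots hA).resolve_right fun h' ↦
      neg_notMem_positiveAffineRoots hP hz (by rw [← map_neg]; exact hpos h')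
  have hsub : g '' Set.range (simpleAffineRoot Δ (P.root t)) ⊆
      Set.range (simpleAffineRoot Δ (P.root t)) := by
    rintro - ⟨-, ⟨i, rfl⟩, rfl⟩
    set α := simpleAffineRoot Δ (P.root t) i with hα
    have hαpos : α ∈ positiveAffineRoots Δ S := simpleAffineRoot_mem ht i
    have hβA := hP.map_mem_affineRoots hg (positiveAffineRoots_subset hαpos)
    have hβ0 := fst_ne_zero_of_mem_affineRoots hβA
    -- With `β = gα`, the reflection `s_β` inverts `β`, hence some simple `α_j = gγ`. If `γ ≠ α`,
    -- then `s_β(gγ) = g(s_α γ)` is positive, a contradiction; so `β = α_j`.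
    obtain ⟨j, hj⟩ := exists_simple_inversion hP ht (hP.affineReflection_mem hβA)
      ⟨g α, hpos hαpos, by rw [affineReflection_self hβ0, neg_neg]; exact hpos hαpos⟩
    refine ⟨j, ?_⟩
    have hjpos := simpleAffineRoot_mem ht j
    obtain ⟨γ, hγ, hγj⟩ := hP.exists_map_eq hg (positiveAffineRoots_subset hjpos)
    rw [← hγj] at hj hjpos ⊢
    congr 1
    by_contra hne
    have h1 := hpos (affineReflection_simple_mem hP ht i (hpos' hjpos hγ) hne)
    rw [← hα, ← Module.End.mul_apply, hP.mul_affineReflection hg, Module.End.mul_apply] at h1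
    exact neg_notMem_positiveAffineRoots hP h1 hj
  have hfin : (Set.range (simpleAffineRoot Δ (P.root t))).Finite := Set.finite_range _
  exact ⟨hg, Set.eq_of_subset_of_ncard_le hsub
    (Set.ncard_image_of_injective _ (hP.injective_of_mem hg)).ge hfin⟩

/-- Simple inversions are stripped off on the right, each lowering the length by one; what remains
at length 0 lies in `Π`. -/
theorem exists_isReducedDecomposition [P.IsRootSystem] {g : Module.End ℝ (V × ℝ)}
    (hg : g ∈ extendedAffineWeyl P S) :
    ∃ π word, IsReducedDecomposition Δ S (P.root t) g π word := by
  induction hn : length Δ S g generalizing g with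
  | zero =>
    exact ⟨g, [], mem_piGroup_of_length_eq_zero hP ht hg hn, by simp, by simp [hn]⟩
  | succ n ih =>
    have hne : {z | z ∈ positiveAffineRoots Δ S ∧ -(g z) ∈ positiveAffineRoots Δ S}.Nonempty := by
      refine Set.nonempty_of_ncard_ne_zero ?_
      rw [length] at hn
      omega
    obtain ⟨i, hi⟩ := exists_simple_inversion hP ht hg hne
    have hlen := length_mul_simple hP ht hg hi
    obtain ⟨π, word, hπ, hprod, hword⟩ := ih (hP.mul_mem_extendedAffineWeyl hg
      (affineReflection_simpleAffineRoot_mem hP ht i)) (by omega)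
    refine ⟨π, word ++ [i], hπ, ?_, by simp only [List.length_append, List.length_singleton]; omega⟩
    rw [List.map_append, List.prod_append, ← mul_assoc, ← hprod, List.map_singleton,
      List.prod_singleton, mul_assoc,
      affineReflection_mul_self (simpleAffineRoot_fst_ne_zero hP ht i), mul_one]

end Length

end AffineWeylGroup

/-! ### Sums with one monomial over each point of a finite set, and the folding action of `T`. -/

section OrbitSections

variable {V : Type*} [NormedAddCommGroup V] [InnerProductSpace ℝ V]

/-- The image of `c` under the linear part of the affine reflection in `α`. -/
theorem affineReflection_fst_snd (α : V × ℝ) (c : V) (ζ : ℝ) :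
    affineReflection α (c, ζ) =
      (c - corootPairing c α.1 • α.1, ζ - corootPairing c α.1 * α.2) := rfl

theorem corootPairing_sub_smul {α : V} (hα : α ≠ 0) (c : V) :
    corootPairing (c - corootPairing c α • α) α = -corootPairing c α := by
  have h : (inner ℝ α α : ℝ) ≠ 0 := fun h ↦ hα (inner_self_eq_zero.1 h)
  simp only [corootPairing, inner_sub_left, real_inner_smul_left]
  field_simp
  ring

theorem inner_sub_smul {α : V} (hα : α ≠ 0) (c : V) :
    (inner ℝ (c - corootPairing c α • α) α : ℝ) = -inner ℝ c α := by
  have h : (inner ℝ α α : ℝ) ≠ 0 := fun h ↦ hα (inner_self_eq_zero.1 h)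
  simp only [corootPairing, inner_sub_left, real_inner_smul_left]
  field_simp
  ring

theorem sub_smul_sub_smul {α : V} (hα : α ≠ 0) (c : V) :
    (c - corootPairing c α • α) - corootPairing (c - corootPairing c α • α) α • α = c := by
  rw [corootPairing_sub_smul hα]; module

/-- `𝕋_α̃` acts on coefficients by composition with the folding along the wall of `α̃`. -/
theorem coeff_T {α : V × ℝ} (hα : α.1 ≠ 0) (F : LaurentRing V) (z : V × ℝ) :
    (T α F).coeff z =
      if (inner ℝ z.1 α.1 : ℝ) ≤ 0 then F.coeff z else F.coeff (affineReflection α z) := by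
  classical
  induction F using AddMonoidAlgebra.induction_linear with
  | zero => simp
  | add F G hF hG =>
    rw [map_add, AddMonoidAlgebra.coeff_add, AddMonoidAlgebra.coeff_add, Finsupp.add_apply, hF, hG]
    split_ifs <;> rfl
  | single y r =>
    have hsingle : (AddMonoidAlgebra.single y r : LaurentRing V) = r • X y := by
      rw [X]
      ext
      simp
    have hrefl (y z : V × ℝ) : affineReflection α y = z ↔ y = affineReflection α z := by
      constructor
      · rintro rfl; rw [affineReflection_affineReflection hα]
      · rintro rfl; rw [affineReflection_affineReflection hα]
    have hinner (z : V × ℝ) : (inner ℝ (affineReflection α z).1 α.1 : ℝ) = -inner ℝ z.1 α.1 :=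
      inner_sub_smul hα z.1
    rw [hsingle, map_smul, T, linearExtension_X]
    simp only [AddMonoidAlgebra.coeff_smul, Finsupp.smul_apply, ← smul_ite]
    congr 1
    have hX (y z : V × ℝ) : (X y : LaurentRing V).coeff z = if y = z then 1 else 0 := by
      simp [X, Finsupp.single_apply]
    rcases lt_trichotomy (inner ℝ y.1 α.1 : ℝ) 0 with h | h | h
    · rw [if_pos h, AddMonoidAlgebra.coeff_add, Finsupp.add_apply, hX, hX, hX]
      simp only [hrefl y z]
      by_cases h1 : y = z
      · subst h1
        have : y ≠ affineReflection α y := by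
          intro h2
          have := hinner y
          rw [← h2] at this
          linarith
        rw [if_neg this, if_pos h.le]; simp
      · by_cases h2 : y = affineReflection α z
        · have h3 := hinner z
          rw [← h2] at h3
          have h4 : ¬ (inner ℝ z.1 α.1 : ℝ) ≤ 0 := by linarith
          simp [h1, ← h2, h4]
        · simp [h1, h2]
    · rw [if_neg h.not_lt, if_pos h, hX, hX]
      have hfixy : affineReflection α y = y := by
        rw [affineReflection_apply, corootPairing, h]; simp
      by_cases h2 : (inner ℝ z.1 α.1 : ℝ) ≤ 0
      · rw [if_pos h2]
      · have h3 : y = z ↔ y = affineReflection α z := by rw [← hrefl, hfixy]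
        rw [if_neg h2]
        exact if_congr h3 rfl rfl
    · rw [if_neg h.not_gt, if_neg h.ne', hX, hX, AddMonoidAlgebra.coeff_zero, Finsupp.zero_apply]
      by_cases h2 : (inner ℝ z.1 α.1 : ℝ) ≤ 0
      · rw [if_pos h2, if_neg]
        rintro rfl
        linarith
      · rw [if_neg h2, if_neg]
        rintro rfl
        rw [hinner] at h
        linarith

/-- The sum of the monomials `q^{a(c)} X_c` over `c ∈ O`. -/
def sectionSum (O : Set V) (a : V → ℝ) : LaurentRing V :=
  ∑ᶠ c ∈ O, X (c, a c)

open Classical in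
theorem coeff_sectionSum {O : Set V} (hO : O.Finite) (a : V → ℝ) (z : V × ℝ) :
    (sectionSum O a).coeff z = if z.1 ∈ O ∧ z.2 = a z.1 then 1 else 0 := by
  have h1 (c : V) : (X (c, a c) : LaurentRing V).coeff z = if c = z.1 then
      (if z.2 = a z.1 then 1 else 0) else 0 := by
    rw [X, AddMonoidAlgebra.coeff_single, Finsupp.single_apply]
    by_cases hc : c = z.1
    · subst hc; simp [Prod.ext_iff, eq_comm]
    · simp [Prod.ext_iff, hc]
  rw [sectionSum, finsum_mem_eq_finite_toFinset_sum _ hO, AddMonoidAlgebra.coeff_sum,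
    Finsupp.finsetSum_apply]
  simp only [h1, Finset.sum_ite_eq', Set.Finite.mem_toFinset]
  split_ifs <;> simp_all

theorem sectionSum_congr {O : Set V} {a a' : V → ℝ} (h : ∀ c ∈ O, a c = a' c) :
    sectionSum O a = sectionSum O a' :=
  finsum_mem_congr rfl fun c hc ↦ by rw [h c hc]

theorem eq_of_sectionSum_eq {O : Set V} (hO : O.Finite) {a a' : V → ℝ}
    (h : sectionSum O a = sectionSum O a') {c : V} (hc : c ∈ O) : a c = a' c := by
  classical
  have h1 := congrArg (fun F : LaurentRing V ↦ F.coeff (c, a c)) h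
  simp only [coeff_sectionSum hO, hc, true_and] at h1
  by_contra hne
  simp [hne] at h1

theorem X_mul_sectionSum {O : Set V} (hO : O.Finite) (a : V → ℝ) (κ : ℝ) :
    X (0, κ) * sectionSum O a = sectionSum O fun c ↦ κ + a c := by
  rw [sectionSum, sectionSum, finsum_mem_eq_finite_toFinset_sum _ hO,
    finsum_mem_eq_finite_toFinset_sum _ hO, Finset.mul_sum]
  refine Finset.sum_congr rfl fun c _ ↦ ?_
  simp [X]

open Classical in
/-- The exponents of `𝕋_α̃ (∑ q^{a(c)} X_c)`. -/
def foldHeight (α : V × ℝ) (a : V → ℝ) (c : V) : ℝ :=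
  if (inner ℝ c α.1 : ℝ) ≤ 0 then a c
  else a (c - corootPairing c α.1 • α.1) + corootPairing c α.1 * α.2

theorem foldHeight_of_nonpos {α : V × ℝ} (a : V → ℝ) {c : V} (h : (inner ℝ c α.1 : ℝ) ≤ 0) :
    foldHeight α a c = a c := if_pos h

/-- The two branches agree on the wall, so each formula is valid on a closed half-space. Additivity
needs this, because of summands lying on the wall. -/
theorem foldHeight_of_nonneg {α : V × ℝ} (a : V → ℝ) {c : V} (h : 0 ≤ (inner ℝ c α.1 : ℝ)) :
    foldHeight α a c = a (c - corootPairing c α.1 • α.1) + corootPairing c α.1 * α.2 := by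
  rcases h.lt_or_eq with h | h
  · exact if_neg h.not_ge
  · have : corootPairing c α.1 = 0 := by rw [corootPairing, ← h]; simp
    rw [foldHeight_of_nonpos a h.ge, this]; simp

/-- The coefficient at `(c, ζ)` is read off at the folded point, over which there is exactly one
monomial. Hence no two monomials over the same point can arise. -/
theorem T_sectionSum {α : V × ℝ} (hα : α.1 ≠ 0) {O : Set V} (hO : O.Finite)
    (hinv : ∀ c ∈ O, c - corootPairing c α.1 • α.1 ∈ O) (a : V → ℝ) :
    T α (sectionSum O a) = sectionSum O (foldHeight α a) := by
  classical
  ext z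
  obtain ⟨c, ζ⟩ := z
  rw [coeff_T hα, coeff_sectionSum hO, coeff_sectionSum hO, coeff_sectionSum hO]
  by_cases h : (inner ℝ c α.1 : ℝ) ≤ 0
  · simp only [h, if_true, foldHeight]
  · simp only [h, if_false, foldHeight, affineReflection_fst_snd]
    have hmem : c - corootPairing c α.1 • α.1 ∈ O ↔ c ∈ O := by
      refine ⟨fun h ↦ ?_, hinv c⟩
      have := hinv _ h
      rwa [sub_smul_sub_smul hα] at this
    exact if_congr (and_congr hmem sub_eq_iff_eq_add) rfl rfl

theorem monomialAction_sectionSum {O : Set V} (hO : O.Finite) {g : Module.End ℝ (V × ℝ)}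
    {f f' : V → V} (hf : ∀ c, f' (f c) = c) (hf' : ∀ c, f (f' c) = c) (hfO : ∀ c ∈ O, f c ∈ O)
    (hfO' : ∀ c ∈ O, f' c ∈ O) {s : V → ℝ} (hg : ∀ c ζ, g (c, ζ) = (f c, ζ + s c)) (a : V → ℝ) :
    monomialAction g (sectionSum O a) = sectionSum O fun c ↦ a (f' c) + s (f' c) := by
  rw [sectionSum, sectionSum, finsum_mem_eq_finite_toFinset_sum _ hO,
    finsum_mem_eq_finite_toFinset_sum _ hO, map_sum]
  refine Finset.sum_nbij' f f' ?_ ?_ ?_ ?_ ?_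
  · simpa using hfO
  · simpa using hfO'
  · exact fun c _ ↦ hf c
  · exact fun c _ ↦ hf' c
  · intro c _
    rw [monomialAction, linearExtension_X, hg, hf]

end OrbitSections

/-! ### Heights of words, described by the Bruhat order. -/

section Heights

variable {ι V N : Type*} [Fintype ι] [NormedAddCommGroup V] [InnerProductSpace ℝ V]
  [AddCommGroup N] [Module ℝ N] {P : RootPairing ι ℝ V N}

/-- The roots span, so a Weyl element acts on `V` through its permutation of the finitely many
roots. -/
theorem finite_weyl_orbit [P.IsRootSystem] (b : V) : (MulAction.orbit P.weylGroup b).Finite := by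
  classical
  have key (u w : P.weylGroup) (h : P.weylGroupToPerm u = P.weylGroupToPerm w) : u • b = w • b := by
    have hlin : DistribSMul.toLinearMap ℝ V u = DistribSMul.toLinearMap ℝ V w := by
      refine LinearMap.ext_on_range (RootPairing.IsRootSystem.span_root_eq_top (P := P)) fun i ↦ ?_
      change u • P.root i = w • P.root i
      rw [P.weylGroup_apply_root, P.weylGroup_apply_root, h]
    exact congrArg (fun f : V →ₗ[ℝ] V ↦ f b) hlin
  refine (Set.finite_range fun σ : Equiv.Perm ι ↦
    if h : ∃ w : P.weylGroup, P.weylGroupToPerm w = σ then h.choose • b else 0).subset ?_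
  rintro - ⟨w, rfl⟩
  have hw : ∃ u : P.weylGroup, P.weylGroupToPerm u = P.weylGroupToPerm w := ⟨w, rfl⟩
  exact ⟨P.weylGroupToPerm w, by simpa only [dif_pos hw] using key _ _ hw.choose_spec⟩

theorem smul_mem_orbit_of_mem {b c : V} (w : P.weylGroup)
    (hc : c ∈ MulAction.orbit P.weylGroup b) : w • c ∈ MulAction.orbit P.weylGroup b := by
  obtain ⟨u, rfl⟩ := hc
  exact ⟨w * u, mul_smul _ _ _⟩

variable {S : Setting} {Δ : P.Base}

theorem reflect_mem_orbit (hP : IsNormalizedForm P) {α : V × ℝ} (hα : α ∈ affineRoots P S)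
    {b c : V} (hc : c ∈ MulAction.orbit P.weylGroup b) :
    c - corootPairing c α.1 • α.1 ∈ MulAction.orbit P.weylGroup b := by
  obtain ⟨i, j, rfl⟩ := hα
  rw [← hP.reflection_apply, ← ofIdx_smul_eq]
  exact smul_mem_orbit_of_mem _ hc

/-- An elementary step of the Bruhat order: `v = u s_δ` with `δ` and `u(δ)` positive. -/
def BruhatStep (Δ : P.Base) (S : Setting) (u v : Module.End ℝ (V × ℝ)) : Prop :=
  ∃ δ ∈ positiveAffineRoots Δ S, u δ ∈ positiveAffineRoots Δ S ∧ v = u * affineReflection δ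

/-- The Bruhat order on the extended affine Weyl group. -/
def BruhatLE (Δ : P.Base) (S : Setting) : Module.End ℝ (V × ℝ) → Module.End ℝ (V × ℝ) → Prop :=
  Relation.ReflTransGen (BruhatStep Δ S)

variable [P.IsCrystallographic]

theorem BruhatStep.eq_mul {u v : Module.End ℝ (V × ℝ)} {δ : V × ℝ}
    (hδ : δ ∈ affineRoots P S) (h : v = u * affineReflection δ) : u = v * affineReflection δ := by
  rw [h, mul_assoc, affineReflection_mul_self (fst_ne_zero_of_mem_affineRoots hδ), mul_one]

theorem BruhatLE.mem (hP : IsNormalizedForm P) {u v : Module.End ℝ (V × ℝ)}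
    (h : BruhatLE Δ S u v) (hv : v ∈ extendedAffineWeyl P S) : u ∈ extendedAffineWeyl P S := by
  induction h using Relation.ReflTransGen.head_induction_on with
  | refl => exact hv
  | head hstep _ ih =>
    obtain ⟨δ, hδ, -, h⟩ := hstep
    have hδA := positiveAffineRoots_subset hδ
    rw [BruhatStep.eq_mul hδA h]
    exact hP.mul_mem_extendedAffineWeyl ih (hP.affineReflection_mem hδA)

variable [P.IsReduced] {t : ι}

section Lifting

variable (hP : IsNormalizedForm P) (ht : IsAffineVertex Δ S t)
include hP ht

/-- Left multiplication by `s_i` keeps `uδ` positive unless `uδ = α_i`, and in that case `s_i u = u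
s_δ` is the upper end of the step. -/
theorem BruhatStep.simple_mul {u v : Module.End ℝ (V × ℝ)} (hu : u ∈ extendedAffineWeyl P S)
    (i : Option Δ.support) (h : BruhatStep Δ S u v) :
    BruhatStep Δ S (affineReflection (simpleAffineRoot Δ (P.root t) i) * u)
        (affineReflection (simpleAffineRoot Δ (P.root t) i) * v) ∨
      v = affineReflection (simpleAffineRoot Δ (P.root t) i) * u := by
  obtain ⟨δ, hδ, huδ, rfl⟩ := h
  by_cases heq : u δ = simpleAffineRoot Δ (P.root t) i
  · right
    rw [← heq, hP.mul_affineReflection hu]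
  · left
    exact ⟨δ, hδ, affineReflection_simple_mem hP ht i huδ heq, by rw [mul_assoc]⟩

theorem bruhatStep_simple_mul {h : Module.End ℝ (V × ℝ)} (hh : h ∈ extendedAffineWeyl P S)
    {i : Option Δ.support}
    (hup : ∃ δ ∈ positiveAffineRoots Δ S, h δ = simpleAffineRoot Δ (P.root t) i) :
    BruhatStep Δ S h (affineReflection (simpleAffineRoot Δ (P.root t) i) * h) := by
  obtain ⟨δ, hδ, hhδ⟩ := hup
  exact ⟨δ, hδ, hhδ ▸ simpleAffineRoot_mem ht i, by rw [← hhδ, hP.mul_affineReflection hh]⟩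

theorem simple_mul_simple_mul (i : Option Δ.support) (u : Module.End ℝ (V × ℝ)) :
    affineReflection (simpleAffineRoot Δ (P.root t) i) *
      (affineReflection (simpleAffineRoot Δ (P.root t) i) * u) = u := by
  rw [← mul_assoc, affineReflection_mul_self (simpleAffineRoot_fst_ne_zero hP ht i), one_mul]

/-- A chain from `v` up to `h` is multiplied by `s_i` step by step. A step that does not survive is
one with `s_i v = v' ≤ h`, and `h ≤ s_i h` by the ascent. -/
theorem BruhatLE.simple_mul_le {h v : Module.End ℝ (V × ℝ)} (hh : h ∈ extendedAffineWeyl P S)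
    {i : Option Δ.support}
    (hup : ∃ δ ∈ positiveAffineRoots Δ S, h δ = simpleAffineRoot Δ (P.root t) i)
    (hv : BruhatLE Δ S v h) :
    BruhatLE Δ S (affineReflection (simpleAffineRoot Δ (P.root t) i) * v)
      (affineReflection (simpleAffineRoot Δ (P.root t) i) * h) := by
  induction hv using Relation.ReflTransGen.head_induction_on with
  | refl => exact Relation.ReflTransGen.refl
  | @head v v' hstep hle ih =>
    have hv : v ∈ extendedAffineWeyl P S := BruhatLE.mem hP (hle.head hstep) hh
    rcases hstep.simple_mul hP ht hv i with h1 | h1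
    · exact ih.head h1
    · rw [← h1]
      exact hle.tail (bruhatStep_simple_mul hP ht hh hup)

theorem BruhatLE.of_le_simple_mul {h v : Module.End ℝ (V × ℝ)} (hh : h ∈ extendedAffineWeyl P S)
    {i : Option Δ.support}
    (hv : BruhatLE Δ S v (affineReflection (simpleAffineRoot Δ (P.root t) i) * h)) :
    BruhatLE Δ S v h ∨
      BruhatLE Δ S (affineReflection (simpleAffineRoot Δ (P.root t) i) * v) h := by
  have hsh := hP.mul_mem_extendedAffineWeyl (affineReflection_simpleAffineRoot_mem hP ht i) hh
  induction hv using Relation.ReflTransGen.head_induction_on with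
  | refl => right; rw [simple_mul_simple_mul hP ht]; exact Relation.ReflTransGen.refl
  | @head v v' hstep hle ih =>
    have hv : v ∈ extendedAffineWeyl P S := BruhatLE.mem hP (hle.head hstep) hsh
    rcases ih with ih | ih
    · exact Or.inl (ih.head hstep)
    · rcases hstep.simple_mul hP ht hv i with h1 | h1
      · exact Or.inr (ih.head h1)
      · left
        rwa [h1, simple_mul_simple_mul hP ht] at ih

/-- The crucial comparison between the semi-infinite and the Bruhat order. -/
theorem exists_le_reflect {h u : Module.End ℝ (V × ℝ)} (hh : h ∈ extendedAffineWeyl P S)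
    (i : Option Δ.support) (hu : BruhatLE Δ S u h) {b d c : V} {ζ : ℝ}
    (hd : d ∈ MulAction.orbit P.weylGroup b) (hud : u (d, 0) = (c, ζ))
    (hc : 0 ≤ (inner ℝ c (simpleAffineRoot Δ (P.root t) i).1 : ℝ)) :
    ∃ v, BruhatLE Δ S v h ∧ ∃ d' ∈ MulAction.orbit P.weylGroup b, ∃ ξ,
      v (d', 0) = ((affineReflection (simpleAffineRoot Δ (P.root t) i) (c, ζ)).1, ξ) ∧
      (affineReflection (simpleAffineRoot Δ (P.root t) i) (c, ζ)).2 ≤ ξ := by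
  set α := simpleAffineRoot Δ (P.root t) i with hα
  have hαpos : α ∈ positiveAffineRoots Δ S := simpleAffineRoot_mem ht i
  have hα0 : α.1 ≠ 0 := simpleAffineRoot_fst_ne_zero hP ht i
  have huW := hu.mem hP hh
  obtain ⟨δ, hδ, huδ⟩ := hP.exists_map_eq huW (positiveAffineRoots_subset hαpos)
  -- Here `δ = u⁻¹(α_i)`. If it is positive, `u` is kept and `d` is reflected in `δ`, which raises
  -- the height by `(d, δ^∨)` times the imaginary part of `δ`. If it is negative, `s_i u` lies below
  -- `u` and `d` is kept.
  rcases mem_or_neg_mem_positiveAffineRoots (Δ := Δ) hδ with hpos | hneg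
  · have hmul : u (affineReflection δ (d, 0)) = affineReflection α (c, ζ) := by
      rw [← Module.End.mul_apply, hP.mul_affineReflection huW, huδ, Module.End.mul_apply, hud]
    have hx : 0 ≤ corootPairing d δ.1 * δ.2 := by
      refine mul_nonneg ?_ (snd_nonneg_of_mem_positiveAffineRoots hpos)
      have h1 := hP.inner_map_map huW (d, 0) δ
      rw [hud, huδ] at h1
      have h2 : 0 ≤ (inner ℝ δ.1 δ.1 : ℝ) := real_inner_self_nonneg
      simp only at h1
      rw [corootPairing, ← h1]
      positivity
    obtain ⟨w, a, ha, hw⟩ := exists_apply_eq huW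
    refine ⟨u, hu, _, reflect_mem_orbit hP hδ hd,
      (affineReflection α (c, ζ)).2 + corootPairing d δ.1 * δ.2, ?_, by linarith⟩
    rw [← hmul, affineReflection_fst_snd, hw, hw]
    ext
    · rfl
    · simp only; ring
  · refine ⟨affineReflection α * u, hu.head ⟨-δ, hneg, ?_, ?_⟩, d, hd,
      (affineReflection α (c, ζ)).2, ?_, le_rfl⟩
    · rw [map_neg, Module.End.mul_apply, huδ, affineReflection_self hα0, neg_neg]
      exact hαpos
    · rw [affineReflection_neg, mul_assoc, hP.mul_affineReflection huW, huδ,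
        simple_mul_simple_mul hP ht]
    · rw [Module.End.mul_apply, hud]

/-- By lifting, an element `v ≤ s_i h` satisfies `v ≤ h` or `s_i v ≤ h`. On the nonpositive side of
the wall `exists_le_reflect` shows that the second kind gives nothing higher than `a c`. On the
positive side the maximum is the reflected one, and the same comparison bounds the first kind. -/
theorem isGreatest_foldHeight {h : Module.End ℝ (V × ℝ)} (hh : h ∈ extendedAffineWeyl P S)
    {i : Option Δ.support}
    (hup : ∃ δ ∈ positiveAffineRoots Δ S, h δ = simpleAffineRoot Δ (P.root t) i) {b : V} {a : V → ℝ}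
    (ha : ∀ c ∈ MulAction.orbit P.weylGroup b, IsGreatest {ζ : ℝ | ∃ v, BruhatLE Δ S v h ∧
      ∃ d ∈ MulAction.orbit P.weylGroup b, v (d, 0) = (c, ζ)} (a c))
    {c : V} (hc : c ∈ MulAction.orbit P.weylGroup b) :
    IsGreatest {ζ : ℝ | ∃ v,
      BruhatLE Δ S v (affineReflection (simpleAffineRoot Δ (P.root t) i) * h) ∧
      ∃ d ∈ MulAction.orbit P.weylGroup b, v (d, 0) = (c, ζ)}
      (foldHeight (simpleAffineRoot Δ (P.root t) i) a c) := by
  set α := simpleAffineRoot Δ (P.root t) i with hα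
  have hαA : α ∈ affineRoots P S := positiveAffineRoots_subset (simpleAffineRoot_mem ht i)
  have hα0 : α.1 ≠ 0 := simpleAffineRoot_fst_ne_zero hP ht i
  have hsc := reflect_mem_orbit hP hαA hc
  by_cases hle : (inner ℝ c α.1 : ℝ) ≤ 0
  · rw [foldHeight_of_nonpos a hle]
    constructor
    · obtain ⟨v, hv, d, hd, hvd⟩ := (ha c hc).1
      exact ⟨v, hv.tail (bruhatStep_simple_mul hP ht hh hup), d, hd, hvd⟩
    · rintro ζ ⟨v, hv, d, hd, hvd⟩
      rcases hv.of_le_simple_mul hP ht hh with hv | hv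
      · exact (ha c hc).2 ⟨v, hv, d, hd, hvd⟩
      · obtain ⟨v', hv', d', hd', ξ, h1, h2⟩ := exists_le_reflect hP ht hh i hv hd
          (c := c - corootPairing c α.1 • α.1) (ζ := ζ - corootPairing c α.1 * α.2)
          (by rw [Module.End.mul_apply, hvd]; rfl)
          (by rw [inner_sub_smul hα0]; linarith)
        rw [← hα, ← affineReflection_fst_snd, affineReflection_affineReflection hα0] at h1 h2
        exact h2.trans ((ha c hc).2 ⟨v', hv', d', hd', h1⟩)
  · rw [foldHeight_of_nonneg a (not_le.1 hle).le]
    constructor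
    · obtain ⟨v, hv, d, hd, hvd⟩ := (ha _ hsc).1
      refine ⟨affineReflection α * v, hv.simple_mul_le hP ht hh hup, d, hd, ?_⟩
      rw [Module.End.mul_apply, hvd, affineReflection_fst_snd, sub_smul_sub_smul hα0,
        corootPairing_sub_smul hα0]
      ext
      · rfl
      · simp only; ring
    · rintro ζ ⟨v, hv, d, hd, hvd⟩
      rw [← sub_le_iff_le_add]
      rcases hv.of_le_simple_mul hP ht hh with hv | hv
      · obtain ⟨v', hv', d', hd', ξ, h1, h2⟩ := exists_le_reflect hP ht hh i hv hd hvd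
          (not_le.1 hle).le
        exact h2.trans ((ha _ hsc).2 ⟨v', hv', d', hd', h1⟩)
      · exact (ha _ hsc).2 ⟨_, hv, d, hd, by rw [Module.End.mul_apply, hvd]; rfl⟩

theorem bruhatLE_one {v : Module.End ℝ (V × ℝ)} (hv : BruhatLE Δ S v 1) : v = 1 := by
  rcases Relation.ReflTransGen.cases_tail hv with h | ⟨u, -, δ, hδ, huδ, h⟩
  · exact h.symm
  · have hδA := positiveAffineRoots_subset hδ
    rw [BruhatStep.eq_mul hδA h, one_mul,
      affineReflection_self (fst_ne_zero_of_mem_affineRoots hδA)] at huδ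
    exact absurd huδ (neg_notMem_positiveAffineRoots hP hδ)

end Lifting

/-- The exponents of `𝕋_{i_l} ⋯ 𝕋_{i_1} (∑ X_c)`. -/
def wordHeight (Δ : P.Base) (θ : V) (word : List (Option Δ.support)) : V → ℝ :=
  word.foldr (fun i a ↦ foldHeight (simpleAffineRoot Δ θ i) a) fun _ ↦ 0

section WordHeight

variable (hP : IsNormalizedForm P) (ht : IsAffineVertex Δ S t)
include hP ht

theorem foldr_T_orbitSum [P.IsRootSystem] (word : List (Option Δ.support)) (b : V) :
    word.foldr (fun i h ↦ T (simpleAffineRoot Δ (P.root t) i) h) (orbitSum P b) =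
      sectionSum (MulAction.orbit P.weylGroup b) (wordHeight Δ (P.root t) word) := by
  induction word with
  | nil => rfl
  | cons i word ih =>
    rw [List.foldr_cons, ih, T_sectionSum (simpleAffineRoot_fst_ne_zero hP ht i)
      (finite_weyl_orbit b) fun c hc ↦ reflect_mem_orbit hP
        (positiveAffineRoots_subset (simpleAffineRoot_mem ht i)) hc]
    rfl

/-- The right-hand description depends only on the product of the word, so heights agree for all
reduced words of one element. -/
theorem isGreatest_wordHeight [P.IsRootSystem] {word : List (Option Δ.support)}
    (hword : word.length = length Δ S (wordProd Δ (P.root t) word)) {b c : V}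
    (hc : c ∈ MulAction.orbit P.weylGroup b) :
    IsGreatest {ζ : ℝ | ∃ v, BruhatLE Δ S v (wordProd Δ (P.root t) word) ∧
      ∃ d ∈ MulAction.orbit P.weylGroup b, v (d, 0) = (c, ζ)}
      (wordHeight Δ (P.root t) word c) := by
  induction word generalizing c with
  | nil =>
    constructor
    · exact ⟨1, Relation.ReflTransGen.refl, c, hc, rfl⟩
    · rintro ζ ⟨v, hv, d, -, hvd⟩
      rw [bruhatLE_one hP ht hv, Module.End.one_apply, Prod.mk.injEq] at hvd
      exact hvd.2.ge
  | cons i word ih =>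
    obtain ⟨h1, h2⟩ := exists_of_length_wordProd_cons hP ht hword
    rw [wordProd_cons]
    exact isGreatest_foldHeight hP ht (wordProd_mem hP ht word) h2
      (fun c hc ↦ ih h1 hc) hc

theorem wordHeight_add (word : List (Option Δ.support)) (w : P.weylGroup) {b c : V}
    (hb : ∀ i ∈ Δ.support, (inner ℝ b (P.root i) : ℝ) ≤ 0)
    (hc : ∀ i ∈ Δ.support, (inner ℝ c (P.root i) : ℝ) ≤ 0) :
    wordHeight Δ (P.root t) word (w • (b + c)) =
      wordHeight Δ (P.root t) word (w • b) + wordHeight Δ (P.root t) word (w • c) := by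
  induction word generalizing w with
  | nil => simp [wordHeight]
  | cons i word ih =>
    change foldHeight _ (wordHeight Δ (P.root t) word) _ =
      foldHeight _ (wordHeight Δ (P.root t) word) _ + foldHeight _ (wordHeight Δ (P.root t) word) _
    set α := simpleAffineRoot Δ (P.root t) i with hα
    obtain ⟨k, j, hk⟩ : α ∈ affineRoots P S :=
      positiveAffineRoots_subset (simpleAffineRoot_mem ht i)
    obtain ⟨l, hl⟩ := exists_root_eq_weyl_smul w⁻¹ k
    have hinner (x : V) : (inner ℝ (w • x) α.1 : ℝ) = inner ℝ x (P.root l) := by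
      rw [hk, ← hl, ← hP.inner_smul_smul w x, smul_inv_smul]
    have hanti (x : V) (hx : ∀ i ∈ Δ.support, (inner ℝ x (P.root i) : ℝ) ≤ 0) (m : ι)
        (hm : Δ.IsPos m) : (inner ℝ x (P.root m) : ℝ) ≤ 0 := by
      have := inner_nonneg_of_isPos (x := -x) (fun i hi ↦ by
        rw [inner_neg_left]; linarith [hx i hi]) hm
      rw [inner_neg_left] at this
      linarith
    -- The root `w⁻¹α` has a fixed sign on the whole antidominant chamber, so `b`, `c` and `b + c`
    -- take the same branch. In the reflected branch `w` becomes `s_k w`, which is why the induction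
    -- generalizes `w`.
    by_cases hlpos : Δ.IsPos l
    · have h1 := hanti b hb l hlpos
      have h2 := hanti c hc l hlpos
      rw [foldHeight_of_nonpos _ (by rw [hinner, inner_add_left]; linarith),
        foldHeight_of_nonpos _ (by rw [hinner]; exact h1),
        foldHeight_of_nonpos _ (by rw [hinner]; exact h2), ih]
    · obtain ⟨m, hm⟩ := exists_root_eq_neg P l
      have hmpos := (IsPos.not_of_root_eq_neg hm).2 hlpos
      have h1 := hanti b hb m hmpos
      have h2 := hanti c hc m hmpos
      rw [hm, inner_neg_right] at h1 h2
      rw [foldHeight_of_nonneg _ (by rw [hinner, inner_add_left]; linarith),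
        foldHeight_of_nonneg _ (by rw [hinner]; linarith),
        foldHeight_of_nonneg _ (by rw [hinner]; linarith)]
      have hs (x : V) : w • x - corootPairing (w • x) α.1 • α.1 =
          (RootPairing.weylGroup.ofIdx P k * w) • x := by
        rw [mul_smul, ofIdx_smul_eq, hP.reflection_apply, hk]
      rw [hs, hs, hs, ih, smul_add]
      simp only [corootPairing, inner_add_left]
      ring

end WordHeight

end Heights

/-! ### Exponents of the dag-polynomials: integrality, sign, and independence of the decomposition.
-/

section DagDegrees

variable {ι V N : Type*} [Fintype ι] [NormedAddCommGroup V] [InnerProductSpace ℝ V]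
  [AddCommGroup N] [Module ℝ N] {P : RootPairing ι ℝ V N} [P.IsRootSystem] [P.IsCrystallographic]
  [P.IsReduced] {S : Setting} {Δ : P.Base} {t : ι}

theorem inner_rhoCheck_eq_of_mem_orbit (hP : IsNormalizedForm P) {b c : V}
    (hb : ∀ i ∈ Δ.support, (inner ℝ b (P.root i) : ℝ) ≤ 0)
    (hc : ∀ i ∈ Δ.support, (inner ℝ c (P.root i) : ℝ) ≤ 0)
    (hbc : c ∈ MulAction.orbit P.weylGroup b) :
    (inner ℝ (rhoCheck Δ S) b : ℝ) = inner ℝ (rhoCheck Δ S) c := by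
  obtain ⟨w, rfl⟩ := hbc
  refine le_antisymm (hP.inner_rhoCheck_le_smul Δ S hb w) ?_
  have := hP.inner_rhoCheck_le_smul Δ S hc w⁻¹
  simpa using this

/-- Every Weyl orbit contains an antidominant element. -/
theorem exists_antidominant (hP : IsNormalizedForm P) (Δ : P.Base) (c : V) :
    ∃ b, c ∈ MulAction.orbit P.weylGroup b ∧
      ∀ i ∈ Δ.support, (inner ℝ b (P.root i) : ℝ) ≤ 0 := by
  -- A minimizer of `(ρ̌, ·)` on the finite orbit is antidominant, since a simple reflection would
  -- otherwise lower the value. Either setting's `ρ̌` would serve.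
  obtain ⟨b, hb, hmin⟩ := Set.exists_min_image _
    (fun x ↦ (inner ℝ (rhoCheck Δ .untwisted) x : ℝ)) (finite_weyl_orbit (P := P) c)
    ⟨c, MulAction.mem_orbit_self c⟩
  refine ⟨b, MulAction.mem_orbit_symm.1 hb, fun i hi ↦ ?_⟩
  have h1 := hmin _ (smul_mem_orbit_of_mem (RootPairing.weylGroup.ofIdx P i) hb)
  rw [ofIdx_smul_eq, hP.reflection_apply, inner_sub_right, real_inner_smul_right] at h1
  have h2 := hP.inner_rhoCheck_pos Δ .untwisted hi
  rw [← corootPairing_nonpos_iff]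
  nlinarith

section PiRho

variable [P.IsIrreducible] (hP : IsNormalizedForm P)
include hP

/-- For `v = u s_δ`, the height changes by `(d, δ^∨)` times the imaginary part of `δ` at `s_δ d`,
and by `-(d, δ^∨)` times that of `uδ` at `d`. Both imaginary parts are nonnegative, so the sign of
`(d, δ^∨)` decides which point to use. The first change is always an integer. -/
theorem BruhatStep.exists_snd_le {u v : Module.End ℝ (V × ℝ)}
    (hu : u ∈ extendedAffineWeyl P S) (h : BruhatStep Δ S u v) {b d : V}
    (hb : b ∈ weightLattice P) (hd : d ∈ MulAction.orbit P.weylGroup b) :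
    (∃ d' ∈ MulAction.orbit P.weylGroup b, (u (d, 0)).2 ≤ (v (d', 0)).2) ∧
    ∃ d' ∈ MulAction.orbit P.weylGroup b, ∃ n : ℤ, (u (d, 0)).2 = (v (d', 0)).2 + n := by
  obtain ⟨δ, hδ, huδ, rfl⟩ := h
  have hδA := positiveAffineRoots_subset hδ
  have hδ0 := fst_ne_zero_of_mem_affineRoots hδA
  obtain ⟨w, a, ha, hw⟩ := exists_apply_eq hu
  have hsd := reflect_mem_orbit hP hδA hd
  have h1 : ((u * affineReflection δ) (d - corootPairing d δ.1 • δ.1, 0)).2 =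
      (u (d, 0)).2 + corootPairing d δ.1 * δ.2 := by
    rw [Module.End.mul_apply, affineReflection_fst_snd, sub_smul_sub_smul hδ0,
      corootPairing_sub_smul hδ0, hw, hw]
    simp only
    ring
  have h2 : ((u * affineReflection δ) (d, 0)).2 =
      (u (d, 0)).2 - corootPairing d δ.1 * (u δ).2 := by
    rw [Module.End.mul_apply, affineReflection_fst_snd, hw, hw, hw]
    simp only [inner_sub_left, real_inner_smul_left]
    ring
  constructor
  · rcases le_total 0 (corootPairing d δ.1) with hc | hc
    · refine ⟨_, hsd, ?_⟩
      rw [h1]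
      linarith [mul_nonneg hc (snd_nonneg_of_mem_positiveAffineRoots hδ)]
    · refine ⟨d, hd, ?_⟩
      rw [h2]
      linarith [mul_nonpos_of_nonpos_of_nonneg hc (snd_nonneg_of_mem_positiveAffineRoots huδ)]
  · refine ⟨_, hsd, ?_⟩
    rw [h1]
    obtain ⟨i, j, rfl⟩ := hδA
    obtain ⟨y, rfl⟩ := hd
    obtain ⟨m, hm⟩ := weyl_smul_mem P y hb i
    obtain ⟨n, hn⟩ := hP.exists_int_spacing S i
    rw [hP.coroot_eq] at hm
    refine ⟨-(m * (n * j)), ?_⟩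
    simp only at hm ⊢
    rw [hm, hn]
    push_cast
    ring

theorem exists_nat_of_bruhatLE_piRho {w₀ : P.weylGroup} {v : Module.End ℝ (V × ℝ)}
    (hv : BruhatLE Δ S v (piRho Δ S w₀)) {b d : V} (hbP : b ∈ weightLattice P)
    (hb : ∀ i ∈ Δ.support, (inner ℝ b (P.root i) : ℝ) ≤ 0)
    (hd : d ∈ MulAction.orbit P.weylGroup b) :
    ∃ n : ℕ, (inner ℝ (rhoCheck Δ S) b : ℝ) + (v (d, 0)).2 = -n := by
  have hg := hP.piRho_mem (Δ := Δ) (S := S) w₀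
  have hval (x : V) : (piRho Δ S w₀ (x, 0)).2 = -inner ℝ (rhoCheck Δ S) (w₀ • x) := by
    rw [piRho, Module.End.mul_apply, ofWeyl_apply, translation_apply, real_inner_comm]
    simp
  -- The inequality and the integrality are carried up the chain with separate orbit points, because
  -- the point that does not lower the height may change from step to step.
  have key : (∃ d' ∈ MulAction.orbit P.weylGroup b, (v (d, 0)).2 ≤ (piRho Δ S w₀ (d', 0)).2) ∧
      ∃ d' ∈ MulAction.orbit P.weylGroup b, ∃ n : ℤ,
        (v (d, 0)).2 = (piRho Δ S w₀ (d', 0)).2 + n := by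
    induction hv using Relation.ReflTransGen.head_induction_on generalizing d with
    | refl => exact ⟨⟨d, hd, le_rfl⟩, d, hd, 0, by simp⟩
    | @head u u' hstep hle ih =>
      have hu := BruhatLE.mem hP (hle.head hstep) hg
      obtain ⟨⟨d₁, hd₁, h1⟩, d₂, hd₂, n, h2⟩ := hstep.exists_snd_le hP hu hbP hd
      obtain ⟨d₃, hd₃, h3⟩ := (ih hd₁).1
      obtain ⟨d₄, hd₄, m, h4⟩ := (ih hd₂).2
      exact ⟨⟨d₃, hd₃, h1.trans h3⟩, d₄, hd₄, m + n, by rw [h2, h4]; push_cast; ring⟩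
  obtain ⟨⟨-, ⟨w₁, rfl⟩, h1⟩, -, ⟨w₂, rfl⟩, n, h2⟩ := key
  simp only [hval, ← mul_smul] at h1 h2
  obtain ⟨m, hm⟩ := hP.exists_int_inner_rhoCheck_smul_sub Δ S hbP (w₀ * w₂)
  have h3 := hP.inner_rhoCheck_le_smul Δ S hb (w₀ * w₁)
  have h4 : (inner ℝ (rhoCheck Δ S) b : ℝ) + (v (d, 0)).2 = ((n - m : ℤ) : ℝ) := by
    push_cast; linarith
  have h5 : n - m ≤ 0 := by
    have : ((n - m : ℤ) : ℝ) ≤ 0 := by linarith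
    exact_mod_cast this
  refine ⟨(m - n).toNat, ?_⟩
  have h6 : (((m - n).toNat : ℤ) : ℝ) = ((m - n : ℤ) : ℝ) := by
    rw [Int.toNat_of_nonneg (by omega)]
  rw [Int.cast_natCast] at h6
  rw [h4, h6]
  push_cast
  ring

end PiRho

variable (hP : IsNormalizedForm P) (ht : IsAffineVertex Δ S t)
include hP ht

/-- Elements of `Π` preserve positivity of affine roots, so left multiplication by `π` matches
Bruhat steps with Bruhat steps. -/
theorem bruhatLE_piGroup_mul_iff {π h v : Module.End ℝ (V × ℝ)}
    (hπ : π ∈ PiGroup Δ S (P.root t)) (hh : h ∈ extendedAffineWeyl P S) :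
    BruhatLE Δ S v (π * h) ↔ ∃ u, BruhatLE Δ S u h ∧ v = π * u := by
  constructor
  · intro hv
    induction hv using Relation.ReflTransGen.head_induction_on with
    | refl => exact ⟨h, Relation.ReflTransGen.refl, rfl⟩
    | @head v v' hstep _ ih =>
      obtain ⟨u, hu, rfl⟩ := ih
      obtain ⟨δ, hδ, hvδ, hv⟩ := hstep
      have hδA := positiveAffineRoots_subset hδ
      rw [BruhatStep.eq_mul hδA hv, mul_assoc] at hvδ ⊢
      refine ⟨_, hu.head ⟨δ, hδ, ?_, ?_⟩, rfl⟩
      · have huW := hP.mul_mem_extendedAffineWeyl (hu.mem hP hh) (hP.affineReflection_mem hδA)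
        refine (mem_or_neg_mem_positiveAffineRoots
          (hP.map_mem_affineRoots huW hδA)).resolve_right fun hneg ↦ ?_
        have := map_pos_of_mem_piGroup hP ht hπ hneg
        rw [map_neg] at this
        exact neg_notMem_positiveAffineRoots hP hvδ this
      · rw [mul_assoc, affineReflection_mul_self (fst_ne_zero_of_mem_affineRoots hδA), mul_one]
  · rintro ⟨u, hu, rfl⟩
    induction hu using Relation.ReflTransGen.head_induction_on with
    | refl => exact Relation.ReflTransGen.refl
    | head hstep _ ih =>
      obtain ⟨δ, hδ, huδ, rfl⟩ := hstep
      exact ih.head ⟨δ, hδ, map_pos_of_mem_piGroup hP ht hπ huδ, by rw [mul_assoc]⟩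

/-- The first two properties together give independence: the polynomial is determined by `A`, and on
each orbit `A` is a maximum defined from `g` alone. -/
theorem exists_dagHeight {g π : Module.End ℝ (V × ℝ)} {word : List (Option Δ.support)}
    (hD : IsReducedDecomposition Δ S (P.root t) g π word) :
    ∃ A : V → ℝ,
      (∀ b, TProduct Δ (P.root t) π word (orbitSum P b) =
        sectionSum (MulAction.orbit P.weylGroup b) A) ∧
      (∀ b, ∀ c ∈ MulAction.orbit P.weylGroup b, IsGreatest {ζ : ℝ | ∃ v, BruhatLE Δ S v g ∧
        ∃ d ∈ MulAction.orbit P.weylGroup b, v (d, 0) = (c, ζ)} (A c)) ∧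
      ∀ (w : P.weylGroup) (b c : V), (∀ i ∈ Δ.support, (inner ℝ b (P.root i) : ℝ) ≤ 0) →
        (∀ i ∈ Δ.support, (inner ℝ c (P.root i) : ℝ) ≤ 0) →
        A (w • (b + c)) = A (w • b) + A (w • c) := by
  obtain ⟨hπ, hprod, hlen⟩ := hD
  change g = π * wordProd Δ (P.root t) word at hprod
  have hmem := wordProd_mem hP ht word
  rw [hprod, length_piGroup_mul hP ht hπ hmem] at hlen
  obtain ⟨y, a, ha, hy⟩ := exists_apply_eq hπ.1
  -- Since `π` is the translation by `a` followed by `y`, the monomial over `c` comes from `y⁻¹ •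
  -- c`, with the height shifted by `-(y⁻¹ • c, a)`.
  refine ⟨fun c ↦ wordHeight Δ (P.root t) word (y⁻¹ • c) + -inner ℝ (y⁻¹ • c) a, ?_, ?_, ?_⟩
  · intro b
    rw [TProduct, foldr_T_orbitSum hP ht]
    exact monomialAction_sectionSum (finite_weyl_orbit b) (f := fun c ↦ y • c)
      (f' := fun c ↦ y⁻¹ • c) (fun c ↦ inv_smul_smul y c) (fun c ↦ smul_inv_smul y c)
      (fun c hc ↦ smul_mem_orbit_of_mem y hc) (fun c hc ↦ smul_mem_orbit_of_mem y⁻¹ hc)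
      (s := fun c ↦ -inner ℝ c a) (fun c ζ ↦ hy (c, ζ)) _
  · intro b c hc
    have hmax := isGreatest_wordHeight hP ht hlen (smul_mem_orbit_of_mem y⁻¹ hc)
    constructor
    · obtain ⟨u, hu, d, hd, hud⟩ := hmax.1
      refine ⟨π * u, ?_, d, hd, ?_⟩
      · rw [hprod, bruhatLE_piGroup_mul_iff hP ht hπ hmem]
        exact ⟨u, hu, rfl⟩
      · rw [Module.End.mul_apply, hud, hy]
        simp only [smul_inv_smul]
        rfl
    · rintro ζ ⟨v, hv, d, hd, hvd⟩
      rw [hprod, bruhatLE_piGroup_mul_iff hP ht hπ hmem] at hv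
      obtain ⟨u, hu, rfl⟩ := hv
      rw [Module.End.mul_apply, hy, Prod.mk.injEq] at hvd
      have h1 : (u (d, 0)).1 = y⁻¹ • c := by rw [← hvd.1, inv_smul_smul]
      have h2 := hmax.2 ⟨u, hu, d, hd, Prod.ext h1 rfl⟩
      rw [h1] at hvd
      linarith [hvd.2]
  · intro w b c hb hc
    simp only [← mul_smul]
    rw [wordHeight_add hP ht word _ hb hc, smul_add, inner_add_left]
    ring

end DagDegrees

end ExtremalDag

end

/-! ### The theorem. -/

open ExtremalDag in
theorem theorem3p2 {ι V N : Type*} [Fintype ι] [NormedAddCommGroup V] [InnerProductSpace ℝ V]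
    [AddCommGroup N] [Module ℝ N]
    (P : RootPairing ι ℝ V N) [P.IsRootSystem] [P.IsCrystallographic] [P.IsReduced]
    [P.IsIrreducible] (hP : IsNormalizedForm P) (Δ : P.Base)
    (S : Setting) (θ : V) (hθ : IsTheta Δ S θ)
    (w₀ : P.weylGroup) (hw₀ : IsLongest Δ S w₀) :
    (∃! e : weightLattice P → ℕ, IsDagExponent Δ S θ w₀ e) ∧
    ∀ e : weightLattice P → ℕ, IsDagExponent Δ S θ w₀ e →
      ∀ b c : weightLattice P, IsDominant Δ b → IsDominant Δ c → ∀ w : P.weylGroup,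
        dagDegree e (b + c) w = dagDegree e b w + dagDegree e c w := by
  obtain ⟨t, rfl, ht⟩ := hθ.exists_isAffineVertex hP
  obtain ⟨π₀, word₀, hD₀⟩ := exists_isReducedDecomposition hP ht (hP.piRho_mem (Δ := Δ) (S := S) w₀)
  obtain ⟨A₀, hA₀, hmax₀, hadd₀⟩ := exists_dagHeight hP ht hD₀
  have hanti (b : weightLattice P) :
      IsAntidominant Δ b ↔ ∀ i ∈ Δ.support, (inner ℝ (b : V) (P.root i) : ℝ) ≤ 0 := by
    refine forall₂_congr fun i _ ↦ ?_
    rw [hP.coroot_eq, corootPairing_nonpos_iff]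
  have hdag {π : Module.End ℝ (V × ℝ)} {word : List (Option Δ.support)} {A : V → ℝ}
      (hA : ∀ b, TProduct Δ (P.root t) π word (orbitSum P b) =
        sectionSum (MulAction.orbit P.weylGroup b) A) (b : V) :
      dagPolynomial Δ S (P.root t) π word b = sectionSum (MulAction.orbit P.weylGroup b)
        fun c ↦ inner ℝ (rhoCheck Δ S) b + A c := by
    rw [dagPolynomial, hA, X_mul_sectionSum (finite_weyl_orbit b)]
  have hmemP {b : weightLattice P} {c : V} (hc : c ∈ MulAction.orbit P.weylGroup (b : V)) :
      c ∈ weightLattice P := by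
    obtain ⟨w, rfl⟩ := hc
    exact weyl_smul_mem P w b.2
  have hrhs (e : weightLattice P → ℕ) (b : weightLattice P) {a : V → ℝ}
      (ha : ∀ c : weightLattice P, a c = -(e c : ℝ)) :
      (∑ᶠ (c : weightLattice P) (_ : (c : V) ∈ MulAction.orbit P.weylGroup (b : V)),
        X ((c : V), -(e c : ℝ))) = sectionSum (MulAction.orbit P.weylGroup (b : V)) a := by
    have hfun (c : weightLattice P) : X ((c : V), -(e c : ℝ)) = X ((c : V), a c) := by rw [ha]
    simp only [hfun]
    rw [sectionSum]
    have himg : MulAction.orbit P.weylGroup (b : V) = Subtype.val ''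
        {c : weightLattice P | (c : V) ∈ MulAction.orbit P.weylGroup (b : V)} := by
      ext c
      exact ⟨fun hc ↦ ⟨⟨c, hmemP hc⟩, hc, rfl⟩, by rintro ⟨c, hc, rfl⟩; exact hc⟩
    conv_rhs => rw [himg, finsum_mem_image Subtype.val_injective.injOn]
    rfl
  have hext (e : weightLattice P → ℕ) : ∃ a : V → ℝ, ∀ c : weightLattice P, a c = -(e c : ℝ) := by
    classical
    exact ⟨fun c ↦ if h : c ∈ weightLattice P then -(e ⟨c, h⟩ : ℝ) else 0, fun c ↦ by simp⟩
  have heq (e : weightLattice P → ℕ) (he : IsDagExponent Δ S (P.root t) w₀ e)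
      (b c : weightLattice P) (hb : IsAntidominant Δ b)
      (hc : (c : V) ∈ MulAction.orbit P.weylGroup (b : V)) :
      (inner ℝ (rhoCheck Δ S) (b : V) : ℝ) + A₀ c = -(e c : ℝ) := by
    obtain ⟨a, ha⟩ := hext e
    have h1 := he π₀ word₀ hD₀ b hb
    rw [hdag hA₀, hrhs e b ha] at h1
    rw [← ha]
    exact eq_of_sectionSum_eq (finite_weyl_orbit _) h1 hc
  have hex (c : weightLattice P) : ∃ b : weightLattice P,
      (c : V) ∈ MulAction.orbit P.weylGroup (b : V) ∧ IsAntidominant Δ b := by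
    obtain ⟨b, hcb, hb⟩ := exists_antidominant hP Δ (c : V)
    refine ⟨⟨b, hmemP (b := c) (MulAction.mem_orbit_symm.1 hcb)⟩, hcb, (hanti _).2 hb⟩
  -- The exponent is required to serve every antidominant `b` in the orbit of `c`. Uniqueness of `b`
  -- is not needed, since `(ρ̌, b)` is the same for all of them.
  have hexn (c : weightLattice P) : ∃ n : ℕ, ∀ b : weightLattice P, IsAntidominant Δ b →
      (c : V) ∈ MulAction.orbit P.weylGroup (b : V) →
      (inner ℝ (rhoCheck Δ S) (b : V) : ℝ) + A₀ c = -(n : ℝ) := by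
    obtain ⟨b, hcb, hb⟩ := hex c
    obtain ⟨v, hv, d, hd, hvd⟩ := (hmax₀ b c hcb).1
    obtain ⟨n, hn⟩ := exists_nat_of_bruhatLE_piRho hP hv b.2 ((hanti b).1 hb) hd
    refine ⟨n, fun b' hb' hcb' ↦ ?_⟩
    have hbb' : (b' : V) ∈ MulAction.orbit P.weylGroup (b : V) := by
      rw [← MulAction.orbit_eq_iff.2 hcb]
      exact MulAction.mem_orbit_symm.1 hcb'
    rw [← inner_rhoCheck_eq_of_mem_orbit hP ((hanti b).1 hb) ((hanti b').1 hb') hbb', ← hn, hvd]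
  choose e₀ he₀ using hexn
  refine ⟨⟨e₀, ?_, ?_⟩, ?_⟩
  · intro π word hD b hb
    obtain ⟨A, hA, hmax, -⟩ := exists_dagHeight hP ht hD
    obtain ⟨a, ha⟩ := hext e₀
    rw [hdag hA, hrhs e₀ b ha]
    refine sectionSum_congr fun c hc ↦ ?_
    have h1 := he₀ ⟨c, hmemP hc⟩ b hb hc
    -- A set has at most one greatest element, so the heights from the given decomposition equal
    -- those from the chosen one.
    rw [(hmax b c hc).unique (hmax₀ b c hc)]
    exact h1.trans (ha ⟨c, hmemP hc⟩).symm
  · intro e he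
    funext c
    obtain ⟨b, hcb, hb⟩ := hex c
    have h1 := heq e he b c hb hcb
    rw [he₀ c b hb hcb, neg_inj] at h1
    exact_mod_cast h1.symm
  · intro e he b c hb hc w
    have hneg {b : weightLattice P} (hb : IsDominant Δ b) : IsAntidominant Δ (-b) := fun i hi ↦ by
      have := hb i hi
      simp only [AddSubgroup.coe_neg, map_neg]
      linarith
    have hdeg (b : weightLattice P) (hb : IsDominant Δ b) :
        (inner ℝ (rhoCheck Δ S) (-(b : V)) : ℝ) + A₀ (w • -(b : V)) = -(dagDegree e b w : ℝ) :=
      heq e he (-b) (weylAct P w (-b)) (hneg hb) ⟨w, rfl⟩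
    have hbc : IsDominant Δ (b + c) := fun i hi ↦ by
      simp only [AddSubgroup.coe_add, map_add]
      exact add_nonneg (hb i hi) (hc i hi)
    have h1 := hdeg b hb
    have h2 := hdeg c hc
    have h3 := hdeg (b + c) hbc
    -- Both summands of the exponent are additive on antidominant weights: `(ρ̌, ·)` by linearity
    -- and `A₀` by the folding argument.
    have h4 := hadd₀ w (-(b : V)) (-(c : V)) ((hanti (-b)).1 (hneg hb)) ((hanti (-c)).1 (hneg hc))
    rw [AddSubgroup.coe_add, neg_add, inner_add_right, h4] at h3
    have h5 : (dagDegree e (b + c) w : ℝ) = dagDegree e b w + dagDegree e c w := by linarith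
    exact_mod_cast h5
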